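/- Setting. Let $W$ be a discrete memoryless channel with finite input alphabet $\mathcal X$, finite output alphabet $\mathcal Y$ and transition probabilities $W(y|x)>0$ for all $x,y$. A variable length block code (with feedback) for a finite message set $\mathcal M$ consists of a Markov time $\tau\in\{1,2,\ldots,\infty\}$ with respect to the output sequence $Y_1,Y_2,\ldots$ (i.e. $\mathbf 1\{\tau=t\}$ is a function of $Y^t=(Y_1,\ldots,Y_t)$) with $P(\tau<\infty)=1$, encoding maps $\Phi(\cdot,y^t):\mathcal M\to\mathcal X$, and a decoding rule $\hat M=\Psi(Y^\tau)\in\mathcal M$. The message $M$ is uniform on $\mathcal M$, and $P(Y_{t+1}=y\mid M,Y^t)=W(y\mid\Phi(M,Y^t))$. Put $P_e=P(\hat M\ne M)$. An anticipative list decoder is a pair $(\tau',\mathcal S)$ in which either $\tau'=0$ and $\mathcal S\subseteq\mathcal M$ is fixed, or $\tau'\geq 1$ is a stopping time with $P(\tau'\le\tau)=1$ and $\mathcal S=\mathcal S(Y^{\tau'})\subseteq\mathcal M$. It is nontrivial if $P(M\in\mathcal S(Y^{\tau'})\mid Y^{\tau'})>0$ with probability one. For a nontrivial $(\tau',\mathcal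 S)$ let $P^{\mathcal S}$ be the probability measure on pairs of a message $m$ and a (finite) output string $y^{t}$ with $\tau=t$ if $Y^t=y^t$, given by $$P^{\mathcal S}(m,y^{t})=P(y^{t'})\,\frac{P(m|y^{t'})\mathbf 1\{m\in\mathcal S(y^{t'})\}}{\sum_{\tilde m\in\mathcal M}P(\tilde m|y^{t'})\mathbf 1\{\tilde m\in\mathcal S(y^{t'})\}}\,P(y_{t'+1}^{t}\mid y^{t'},m),$$ where $t'$ is the value of $\tau'$ on $y^t$. Let $h(s)=-s\ln s-(1-s)\ln(1-s)$, let $H(M|Y^{t})=\sum_{m}P(M=m|Y^{t})\ln\frac1{P(M=m|Y^{t})}$ (a random variable), and let $$J(R)=\max\Big\{\alpha D(\psi_1\|W_{x_1})+(1-\alpha)D(\psi_2\|W_{x_2})\Big\},$$ where the maximum is over $\alpha\in[0,1]$, $x_1,x_2\in\mathcal X$ and probability distributions $\varphi_1,\varphi_2$ on $\mathcal X$ with $\alpha I(\varphi_1,W)+(1-\alpha)I(\varphi_2,W)\ge R$, $\psi_i=\sum_x\varphi_i(x)W_x$ being the output distribution of $\varphi_i$, $W_x=W(\cdot|x)$,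 $I$ the mutual information and $D$ the Kullback–Leibler divergence. Lemma. Consider a variable length block code with $E[\tau]<\infty$ and $k$ nontrivial anticipative list decoders $(\tau_1,\mathcal S_1),\ldots,(\tau_k,\mathcal S_k)$ with $P(0\le\tau_1\le\tau_2\le\cdots\le\tau_k\le\tau)=1$. Put $\tau_0=0$, $\tau_{k+1}=\tau$ and, for $1\le j\le k+1$, $$\rho_j=\begin{cases}0&\text{if }P(\tau_j=\tau_{j-1})=1,\\ \dfrac{E[H(M|Y^{\tau_{j-1}})-H(M|Y^{\tau_j})]}{E[\tau_j-\tau_{j-1}]}&\text{if }P(\tau_j=\tau_{j-1})<1.\end{cases}$$ Then for all $i\in\{1,\ldots,k\}$ such that $P(M\in\mathcal S_i(Y^{\tau_i}))+P_e\le 1/2$ we have $$P^{\mathcal S_i}\big(\hat M\notin\mathcal S_i(Y^{\tau_i})\big)\ \ge\ \exp\left(\frac{-h\big(P_e+P(M\in\mathcal S_i(Y^{\tau_i}))\big)-\sum_{j=i+1}^{k+1}E[\tau_j-\tau_{j-1}]\,J(\rho_j)}{1-P_e-P(M\in\mathcal S_i(Y^{\tau_i}))}\right).$$ -/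

import Mathlib

open MeasureTheory

/-- A discrete memoryless channel with input alphabet `X` and output alphabet `Y`,
all of whose transition probabilities are positive. -/
structure DMC (X Y : Type*) [Fintype Y] where
  W : X → Y → ℝ
  pos : ∀ x y, 0 < W x y
  sum_one : ∀ x, ∑ y, W x y = 1

namespace DMC

variable {X Y : Type*} [Fintype X] [Fintype Y]

/-- Output distribution of the channel for the input distribution `φ`. -/
noncomputable def outDist (K : DMC X Y) (φ : X → ℝ) (y : Y) : ℝ :=
  ∑ x, K.W x y * φ x

/-- Mutual information (in nats) between input and output for the input distribution `φ`. -/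
noncomputable def mutualInfo (K : DMC X Y) (φ : X → ℝ) : ℝ :=
  ∑ x, ∑ y, φ x * K.W x y * Real.log (K.W x y / K.outDist φ y)

/-- Kullback-Leibler divergence (in nats) of `q` from the output distribution of the letter `x`. -/
noncomputable def klTo (K : DMC X Y) (q : Y → ℝ) (x : X) : ℝ :=
  ∑ y, q y * Real.log (q y / K.W x y)

/-- The function `J` of the channel: the maximum of `α D(ψ₁ ‖ W_{x₁}) + (1 - α) D(ψ₂ ‖ W_{x₂})`,
`ψᵢ` being the output distribution of `φᵢ`, subject to
`α I(φ₁, W) + (1 - α) I(φ₂, W) ≥ R`. -/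
noncomputable def J (K : DMC X Y) (R : ℝ) : ℝ :=
  sSup {v : ℝ | ∃ (α : ℝ) (x₁ x₂ : X) (φ₁ φ₂ : X → ℝ),
    0 ≤ α ∧ α ≤ 1 ∧ φ₁ ∈ stdSimplex ℝ X ∧ φ₂ ∈ stdSimplex ℝ X ∧
    R ≤ α * K.mutualInfo φ₁ + (1 - α) * K.mutualInfo φ₂ ∧
    v = α * K.klTo (K.outDist φ₁) x₁ + (1 - α) * K.klTo (K.outDist φ₂) x₂}

end DMC

/-- The first `n` letters of the infinite sequence `y`
(the letter at time `t + 1` is `y t`). -/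
def firstLetters {Y : Type*} (y : ℕ → Y) (n : ℕ) : List Y :=
  (List.range n).map y

/-- A Markov time: whether `T = n` depends on the first `n` letters only.
For `n = 0` this says that `T` is either the constant `0` or everywhere positive. -/
def IsMarkovTime {Y : Type*} (T : (ℕ → Y) → ℕ∞) : Prop :=
  ∀ (n : ℕ) (y y' : ℕ → Y), firstLetters y n = firstLetters y' n → T y = n → T y' = n

/-- The letters of `y` up to the time `T` (used where `T y < ∞`). -/
def upTo {Y : Type*} (T : (ℕ → Y) → ℕ∞) (y : ℕ → Y) : List Y :=
  firstLetters y (T y).toNat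

/-- The finite strings `s` such that `T` is the length of `s` as soon as the sequence
starts with `s`. -/
def stoppedStrings {Y : Type*} (T : (ℕ → Y) → ℕ∞) : Set (List Y) :=
  {s | ∀ y : ℕ → Y, firstLetters y s.length = s → T y = s.length}

/-- The initial piece, up to the time `T`, of the finite string `s` (used where `T` is reached
within `s`, so that the way in which `s` is continued does not matter). -/
noncomputable def cutAt {Y : Type*} [Nonempty Y] (T : (ℕ → Y) → ℕ∞) (s : List Y) : List Y :=
  s.take (T (fun t => s.getD t (Classical.arbitrary Y))).toNat

/-- A variable length block code with feedback: an encoding scheme, a decoding time and a decoding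
rule. The values of `enc` at strings beyond the decoding time, and those of `dec` at strings at
which the decoding time is not reached, play no role. -/
structure VLCode (X Y M : Type*) where
  enc : M → List Y → X
  time : (ℕ → Y) → ℕ∞
  dec : List Y → M
  markov : IsMarkovTime time
  time_pos : ∀ y, 1 ≤ time y

/-- A probability space with a message, uniform on `M`, and the sequence of the channel outputs
when the message is sent over the channel `K` by means of the code `C`; the decoding time is
finite with probability one. -/
structure CodeProcess {X Y M : Type*} [Fintype Y] [Fintype M] (K : DMC X Y) (C : VLCode X Y M)
    (Ω : Type*) [MeasurableSpace Ω] where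
  μ : Measure Ω
  prob : IsProbabilityMeasure μ
  mes : Ω → M
  out : Ω → ℕ → Y
  measurable_mes : ∀ m, MeasurableSet {ω | mes ω = m}
  measurable_out : ∀ t y, MeasurableSet {ω | out ω t = y}
  uniform : ∀ m, μ.real {ω | mes ω = m} = 1 / (Fintype.card M : ℝ)
  channel : ∀ (m : M) (s : List Y) (y : Y),
    μ.real {ω | mes ω = m ∧ firstLetters (out ω) (s.length + 1) = s ++ [y]} =
      μ.real {ω | mes ω = m ∧ firstLetters (out ω) s.length = s} * K.W (C.enc m s) y
  time_finite : ∀ᵐ ω ∂μ, C.time (out ω) < ⊤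

namespace CodeProcess

variable {X Y M : Type*} [Fintype Y] [Fintype M] {K : DMC X Y} {C : VLCode X Y M}
  {Ω : Type*} [MeasurableSpace Ω]

/-- The decoded message. -/
def est (P : CodeProcess K C Ω) (ω : Ω) : M := C.dec (upTo C.time (P.out ω))

/-- The error probability. -/
noncomputable def errProb (P : CodeProcess K C Ω) : ℝ := P.μ.real {ω | P.est ω ≠ P.mes ω}

/-- The probability that the outputs start with `s`. -/
noncomputable def pOut (P : CodeProcess K C Ω) (s : List Y) : ℝ :=
  P.μ.real {ω | firstLetters (P.out ω) s.length = s}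

/-- The probability that the message is `m` and the outputs start with `s`. -/
noncomputable def pJoint (P : CodeProcess K C Ω) (m : M) (s : List Y) : ℝ :=
  P.μ.real {ω | P.mes ω = m ∧ firstLetters (P.out ω) s.length = s}

/-- Posterior probability of the message `m` given that the outputs start with `s`. -/
noncomputable def posterior (P : CodeProcess K C Ω) (m : M) (s : List Y) : ℝ :=
  P.pJoint m s / P.pOut s

/-- Entropy (in nats) of the message given that the outputs start with `s`. -/
noncomputable def condEntropy (P : CodeProcess K C Ω) (s : List Y) : ℝ :=
  ∑ m, Real.negMulLog (P.posterior m s)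

/-- Posterior probability, given that the outputs start with `s`, that the message lies in the
list `A s`. -/
noncomputable def posteriorList (P : CodeProcess K C Ω) (A : List Y → Set M) (s : List Y) : ℝ :=
  ∑ m, (A s).indicator (fun m => P.posterior m s) m

/-- `(T, A)` is an anticipative list decoder: `T` is a stopping time (or the constant `0`) which
with probability one does not exceed the decoding time, and `A` assigns a list of messages to the
outputs up to `T`. -/
structure IsALD (P : CodeProcess K C Ω) (T : (ℕ → Y) → ℕ∞) (_A : List Y → Set M) : Prop where
  markov : IsMarkovTime T
  finite : ∀ᵐ ω ∂P.μ, T (P.out ω) < ⊤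
  le_time : ∀ᵐ ω ∂P.μ, T (P.out ω) ≤ C.time (P.out ω)

/-- `(T, A)` is a nontrivial anticipative list decoder. -/
structure IsNALD (P : CodeProcess K C Ω) (T : (ℕ → Y) → ℕ∞) (A : List Y → Set M) : Prop
    extends P.IsALD T A where
  nontrivial : ∀ᵐ ω ∂P.μ, 0 < P.posteriorList A (upTo T (P.out ω))

/-- The probability that the message lies in the list. -/
noncomputable def probMesMem (P : CodeProcess K C Ω) (T : (ℕ → Y) → ℕ∞) (A : List Y → Set M) :
    ℝ :=
  P.μ.real {ω | P.mes ω ∈ A (upTo T (P.out ω))}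

/-- The tilted probability distribution `P^A` on pairs of a message `m` and a string `s` of outputs
up to the decoding time: with `u` the piece of `s` up to `T`, it is
`P(u) * P(m | u, m ∈ A u) * P(rest of s | u, m)`. -/
noncomputable def tiltedMass [Nonempty Y] (P : CodeProcess K C Ω) (T : (ℕ → Y) → ℕ∞)
    (A : List Y → Set M) (m : M) (s : List Y) : ℝ :=
  P.pOut (cutAt T s) *
    ((A (cutAt T s)).indicator (fun m => P.posterior m (cutAt T s)) m /
      P.posteriorList A (cutAt T s)) *
    (P.pJoint m s / P.pJoint m (cutAt T s))

/-- The tilted probability measure `P^A` of a set of pairs of a message and a string of outputs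
up to the decoding time. -/
noncomputable def tiltedProb [Nonempty Y] (P : CodeProcess K C Ω) (T : (ℕ → Y) → ℕ∞)
    (A : List Y → Set M) (E : Set (M × List Y)) : ℝ :=
  ∑' p : ↥{p : M × List Y | p ∈ E ∧ p.2 ∈ stoppedStrings C.time},
    P.tiltedMass T A p.1.1 p.1.2

/-- The expected duration `E[T' - T]` of the interval from `T` to `T'`. -/
noncomputable def expDuration (P : CodeProcess K C Ω) (T T' : (ℕ → Y) → ℕ∞) : ℝ :=
  ∫ ω, (((T' (P.out ω)).toNat : ℝ) - ((T (P.out ω)).toNat : ℝ)) ∂P.μ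

open Classical in
/-- Expected decrease of the conditional entropy of the message per unit time in the interval
from `T` to `T'`. -/
noncomputable def entropyRate (P : CodeProcess K C Ω) (T T' : (ℕ → Y) → ℕ∞) : ℝ :=
  if ∀ᵐ ω ∂P.μ, T' (P.out ω) = T (P.out ω) then 0
  else (∫ ω, (P.condEntropy (upTo T (P.out ω)) - P.condEntropy (upTo T' (P.out ω))) ∂P.μ) /
    P.expDuration T T'

end CodeProcess

/-!
Fix one of the list decoders, `(T, A)`, and compare the law `p` of the outputs up to the decoding
time with their law `q` under the tilted distribution.

*Data processing.* The test "the decoded message is not in the list" has `p`-probability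
`a ≥ 1 - P_e - P(M ∈ A) ≥ 1/2`, so the divergence of `p` from `q` is at least
`-h(a) - a log b`, where `b` is the tilted probability of the same event
(`neg_binEntropy_sub_mul_log_le`). As `h` is decreasing on `[1/2, 1]` and `log b ≤ 0`, the number
`a` may be replaced by its lower bound (`IsNALD.exp_le_tiltedProb`), and it remains to bound the
divergence, which is the expectation of the log-likelihood ratio `log (p / q)` at the decoding time.

*Optional stopping.* A function `g` of the outputs so far with bounded increments changes between
two Markov times on average by the integral of its one-step drift against the occupation measure
of the output strings met in between (`integral_sub_upTo`); the total mass of this measure is the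
expected duration. Three functions matter. For minus the conditional entropy of the message
the drift is the mutual information of the channel for the current input distribution `φ`
(`drift_neg_condEntropy`). For `log (p / q)` it is the divergence of the output distribution of `φ`
from a mixture of rows of the channel, hence at most its divergence from a single row
(`IsNALD.exists_drift_logRatio_le`); this uses that under `q` the message still drives the channel
in the same way, only with another posterior distribution (`IsNALD.tiltOut_append`). For the length
the drift is `1`.

*Concavity.* At every string the pair of the two drifts is thus dominated by a point of the compact
set of pairs `(I(φ), D(ψ ‖ W_x))`. Its mean over the occupation measure is dominated by a point of
the convex hull, and in the plane two points of the set suffice to dominate that one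
(`exists_two_point_dominating_average`): this is exactly the form of `J`, so the mean increase of
`log (p / q)` on an interval between consecutive stopping times is at most the duration times `J`
at the entropy rate (`IsNALD.integral_logRatio_sub_le`). As `log (p / q)` vanishes when the list is
formed, summing over the intervals bounds the divergence.

The positivity of the transition probabilities enters twice: it bounds the increments of
`log (p / q)`, and it gives every output string positive probability, so that statements that hold
almost surely hold at every string.
-/

/-! ### Two-point dominance in the plane -/

/-- Convex weights on at least three points of the plane can be moved, keeping the first coordinate
of the combination and not decreasing the second, until one of the points drops out: the total mass
and the first coordinate impose only two linear conditions on a direction of motion. -/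
theorem exists_convexCombination_erase {ι : Type*} [DecidableEq ι] (z : ι → ℝ × ℝ) (t : Finset ι)
    (ht : 3 ≤ t.card) (w : ι → ℝ) (hw : ∀ i ∈ t, 0 ≤ w i) (hw1 : ∑ i ∈ t, w i = 1) :
    ∃ j ∈ t, ∃ w' : ι → ℝ, (∀ i ∈ t.erase j, 0 ≤ w' i) ∧ ∑ i ∈ t.erase j, w' i = 1 ∧
      ∑ i ∈ t.erase j, w' i * (z i).1 = ∑ i ∈ t, w i * (z i).1 ∧
      ∑ i ∈ t, w i * (z i).2 ≤ ∑ i ∈ t.erase j, w' i * (z i).2 := by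
  obtain ⟨v, hv0, hv1, hvz, hvD⟩ : ∃ v : ι → ℝ, (∃ i ∈ t, v i ≠ 0) ∧ ∑ i ∈ t, v i = 0 ∧
      ∑ i ∈ t, v i * (z i).1 = 0 ∧ 0 ≤ ∑ i ∈ t, v i * (z i).2 := by
    let F : (t → ℝ) →ₗ[ℝ] ℝ × ℝ :=
      { toFun := fun v => (∑ i, v i, ∑ i, v i * (z i).1)
        map_add' := fun a b => by simp [Finset.sum_add_distrib, add_mul]
        map_smul' := fun a b => by simp [Finset.mul_sum, mul_assoc] }
    have hF : LinearMap.ker F ≠ ⊥ := by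
      apply F.ker_ne_bot_of_finrank_lt
      simp
      omega
    obtain ⟨v, hv, hv0⟩ := (Submodule.ne_bot_iff _).1 hF
    have hv' : ∑ i, v i = 0 ∧ ∑ i, v i * (z i).1 = 0 := by
      simpa [F, Prod.ext_iff] using hv
    obtain ⟨i, hi⟩ := Function.ne_iff.1 hv0
    let u : ι → ℝ := fun i => if h : i ∈ t then v ⟨i, h⟩ else 0
    have hu : ∀ i : t, u i = v i := fun i => by simp [u]
    have hsum : ∀ f : ι → ℝ, ∑ i ∈ t, u i * f i = ∑ i, v i * f i := fun f => by
      rw [← Finset.sum_coe_sort]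
      exact Finset.sum_congr rfl fun i _ => by rw [hu]
    have h1 : ∑ i ∈ t, u i = 0 := by simpa using (hsum fun _ => 1).trans (by simpa using hv'.1)
    rcases le_total 0 (∑ i ∈ t, u i * (z i).2) with h | h
    · exact ⟨u, ⟨i, i.2, by simpa [hu] using hi⟩, h1, by rw [hsum, hv'.2], h⟩
    · refine ⟨-u, ⟨i, i.2, by simpa [hu] using hi⟩, by simp [h1], ?_, ?_⟩
      · have h2 : ∑ i ∈ t, u i * (z i).1 = 0 := by rw [hsum, hv'.2]
        simpa using h2
      · simpa using h
  have hneg : (t.filter fun i => v i < 0).Nonempty := by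
    by_contra hne
    rw [Finset.not_nonempty_iff_eq_empty, Finset.filter_eq_empty_iff] at hne
    have h0 : ∀ i ∈ t, 0 ≤ v i := fun i hi => not_lt.1 (hne hi)
    obtain ⟨i, hi, hi'⟩ := hv0
    exact hi' ((Finset.sum_eq_zero_iff_of_nonneg h0).1 hv1 i hi)
  -- the largest step along `v` that keeps the weights nonnegative
  obtain ⟨j, hj, hmin⟩ := Finset.exists_min_image _ (fun i => w i / (-v i)) hneg
  rw [Finset.mem_filter] at hj
  set s := w j / (-v j) with hs
  have hs0 : 0 ≤ s := div_nonneg (hw j hj.1) (by linarith [hj.2])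
  have hzero : w j + s * v j = 0 := by
    have : v j ≠ 0 := hj.2.ne
    rw [hs]; field_simp; ring
  have hE : ∀ f : ι → ℝ, ∑ i ∈ t.erase j, (w i + s * v i) * f i =
      ∑ i ∈ t, w i * f i + s * ∑ i ∈ t, v i * f i := fun f => by
    rw [Finset.sum_erase _ (by rw [hzero, zero_mul]), Finset.mul_sum, ← Finset.sum_add_distrib]
    exact Finset.sum_congr rfl fun i _ => by ring
  refine ⟨j, hj.1, fun i => w i + s * v i, fun i hi => ?_, ?_, ?_, ?_⟩
  · have hit := Finset.mem_of_mem_erase hi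
    rcases lt_or_ge (v i) 0 with h | h
    · have := hmin i (Finset.mem_filter.2 ⟨hit, h⟩)
      rw [le_div_iff₀ (by linarith)] at this
      linarith
    · have := hw i hit
      positivity
  · have := hE fun _ => 1
    simp only [mul_one] at this
    rw [this, hw1, hv1]; ring
  · rw [hE fun i => (z i).1, hvz]; ring
  · rw [hE fun i => (z i).2]
    have := mul_nonneg hs0 hvD
    linarith

/-- Every convex combination of points of the plane is dominated by one of two of these points. -/
theorem exists_two_point_dominating {ι : Type*} (z : ι → ℝ × ℝ) (t : Finset ι) (w : ι → ℝ)
    (hw : ∀ i ∈ t, 0 ≤ w i) (hw1 : ∑ i ∈ t, w i = 1) :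
    ∃ a : ℝ, 0 ≤ a ∧ a ≤ 1 ∧ ∃ i ∈ t, ∃ j ∈ t, ∑ i ∈ t, w i • z i ≤ a • z i + (1 - a) • z j := by
  classical
  induction hn : t.card using Nat.strong_induction_on generalizing t w with
  | _ n ih =>
  rcases le_or_gt 3 t.card with h3 | h3
  · obtain ⟨j, hj, w', h0, h1, hf, hs⟩ := exists_convexCombination_erase z t h3 w hw hw1
    obtain ⟨a, ha0, ha1, i, hi, i', hi', hle⟩ := ih _ (hn ▸ Finset.card_erase_lt_of_mem hj)
      (t.erase j) w' h0 h1 rfl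
    refine ⟨a, ha0, ha1, i, Finset.mem_of_mem_erase hi, i', Finset.mem_of_mem_erase hi',
      le_trans ?_ hle⟩
    constructor
    · simpa [Prod.fst_sum] using hf.ge
    · simpa [Prod.snd_sum] using hs
  · have : t.card = 0 ∨ t.card = 1 ∨ t.card = 2 := by omega
    rcases this with h | h | h
    · rw [Finset.card_eq_zero] at h
      simp [h] at hw1
    · obtain ⟨i, rfl⟩ := Finset.card_eq_one.1 h
      simp only [Finset.sum_singleton] at hw1 ⊢
      exact ⟨1, by simp, le_rfl, i, by simp, i, by simp, by simp [hw1]⟩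
    · obtain ⟨i, j, hij, rfl⟩ := Finset.card_eq_two.1 h
      rw [Finset.sum_pair hij] at hw1 ⊢
      have := hw i (by simp)
      have := hw j (by simp)
      exact ⟨w i, by simpa, by linarith, i, by simp, j, by simp, by
        rw [show 1 - w i = w j by linarith]⟩

open scoped Pointwise in
/-- The mean of a function whose values are dominated by points of a compact planar set is
dominated by a convex combination of two points of that set. -/
theorem exists_two_point_dominating_average {α : Type*} [MeasurableSpace α] (ν : Measure α)
    [IsFiniteMeasure ν] [NeZero ν] {S : Set (ℝ × ℝ)} (hS : IsCompact S) {f : α → ℝ × ℝ}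
    (hf : Integrable f ν) (hfS : ∀ᵐ x ∂ν, ∃ z ∈ S, f x ≤ z) :
    ∃ a : ℝ, 0 ≤ a ∧ a ≤ 1 ∧ ∃ z ∈ S, ∃ z' ∈ S, ⨍ x, f x ∂ν ≤ a • z + (1 - a) • z' := by
  let Z : Set (ℝ × ℝ) := (fun p : ℝ × (ℝ × ℝ) × (ℝ × ℝ) => p.1 • p.2.1 + (1 - p.1) • p.2.2) ''
    (Set.Icc 0 1 ×ˢ S ×ˢ S)
  have hZ : IsCompact Z := (isCompact_Icc.prod (hS.prod hS)).image (by fun_prop)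
  let U : Set (ℝ × ℝ) := {p | ∃ z ∈ convexHull ℝ S, p ≤ z}
  have hUZ : U = Set.Iic 0 + Z := by
    ext p
    constructor
    · rintro ⟨z, hz, hpz⟩
      rw [convexHull_eq (R := ℝ)] at hz
      obtain ⟨ι, t, w, y, hw, hw1, hy, rfl⟩ := hz
      obtain ⟨a, ha0, ha1, i, hi, j, hj, hle⟩ := exists_two_point_dominating y t w hw hw1
      rw [Finset.centerMass_eq_of_sum_1 _ _ hw1] at hpz
      refine Set.mem_add.2 ⟨p - (a • y i + (1 - a) • y j), ?_, a • y i + (1 - a) • y j,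
        ⟨(a, y i, y j), ⟨⟨ha0, ha1⟩, hy i hi, hy j hj⟩, rfl⟩, by abel⟩
      exact sub_nonpos.2 (hpz.trans hle)
    · rintro ⟨u, hu, _, ⟨⟨a, z, z'⟩, ⟨⟨ha0, ha1⟩, hz, hz'⟩, rfl⟩, rfl⟩
      refine ⟨a • z + (1 - a) • z', ?_, ?_⟩
      · exact convex_convexHull ℝ S (subset_convexHull ℝ S hz) (subset_convexHull ℝ S hz') ha0
          (by simpa using ha1) (by ring)
      · simpa using hu
  have hclosed : IsClosed U := hUZ ▸ isClosed_Iic.add_right_of_isCompact hZ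
  have hconv : Convex ℝ U := by
    rintro p ⟨z, hz, hpz⟩ p' ⟨z', hz', hpz'⟩ a b ha hb hab
    exact ⟨a • z + b • z', convex_convexHull ℝ S hz hz' ha hb hab,
      add_le_add (smul_le_smul_of_nonneg_left hpz ha) (smul_le_smul_of_nonneg_left hpz' hb)⟩
  have hmem : ⨍ x, f x ∂ν ∈ U := hconv.average_mem hclosed
    (hfS.mono fun x ⟨z, hz, hle⟩ => ⟨z, subset_convexHull ℝ S hz, hle⟩) hf
  rw [hUZ] at hmem
  obtain ⟨u, hu, _, ⟨⟨a, z, z'⟩, ⟨⟨ha0, ha1⟩, hz, hz'⟩, rfl⟩, h⟩ := hmem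
  refine ⟨a, ha0, ha1, z, hz, z', hz', ?_⟩
  rw [← h]
  simpa using hu

/-! ### Single-letter quantities of the channel -/

namespace DMC

variable {X Y : Type*} [Fintype Y]

theorem outDist_pos [Fintype X] (K : DMC X Y) {φ : X → ℝ} (hφ : φ ∈ stdSimplex ℝ X) (y : Y) :
    0 < K.outDist φ y := by
  obtain ⟨x, hx⟩ : ∃ x, φ x ≠ 0 := by
    by_contra! h
    simpa [h] using hφ.2
  exact Finset.sum_pos' (fun x _ => mul_nonneg (K.pos x y).le (hφ.1 x))
    ⟨x, Finset.mem_univ x, mul_pos (K.pos x y) (lt_of_le_of_ne (hφ.1 x) hx.symm)⟩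

theorem continuous_outDist [Fintype X] (K : DMC X Y) (y : Y) :
    Continuous fun φ => K.outDist φ y := by
  unfold outDist
  fun_prop

/-- The pairs of a mutual information and a divergence that the channel makes possible. -/
def infoDivSet [Fintype X] (K : DMC X Y) : Set (ℝ × ℝ) :=
  {z | ∃ φ ∈ stdSimplex ℝ X, ∃ x, z = (K.mutualInfo φ, K.klTo (K.outDist φ) x)}

theorem isCompact_infoDivSet [Fintype X] (K : DMC X Y) : IsCompact K.infoDivSet := by
  have h : K.infoDivSet = ⋃ x, (fun φ => (K.mutualInfo φ, K.klTo (K.outDist φ) x)) ''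
      stdSimplex ℝ X := by
    ext z
    simp only [infoDivSet, Set.mem_ofPred_eq, Set.mem_iUnion, Set.mem_image]
    constructor
    · rintro ⟨φ, hφ, x, rfl⟩
      exact ⟨x, φ, hφ, rfl⟩
    · rintro ⟨x, φ, hφ, rfl⟩
      exact ⟨φ, hφ, x, rfl⟩
  rw [h]
  refine isCompact_iUnion fun x => (isCompact_stdSimplex ℝ X).image_of_continuousOn ?_
  refine ContinuousOn.prodMk ?_ ?_
  · unfold mutualInfo
    refine continuousOn_finsetSum _ fun x _ => continuousOn_finsetSum _ fun y _ => ?_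
    refine ContinuousOn.mul (by fun_prop) (ContinuousOn.log ?_ fun φ hφ => ?_)
    · exact continuousOn_const.div (K.continuous_outDist y).continuousOn
        fun φ hφ => (K.outDist_pos hφ y).ne'
    · exact (div_pos (K.pos x y) (K.outDist_pos hφ y)).ne'
  · unfold klTo
    refine continuousOn_finsetSum _ fun y _ => ?_
    refine ContinuousOn.mul (K.continuous_outDist y).continuousOn
      (ContinuousOn.log ?_ fun φ hφ => ?_)
    · exact (K.continuous_outDist y).continuousOn.div_const _
    · exact (div_pos (K.outDist_pos hφ y) (K.pos x y)).ne'

theorem le_J [Fintype X] (K : DMC X Y) {R a : ℝ} (ha0 : 0 ≤ a) (ha1 : a ≤ 1) {z z' : ℝ × ℝ}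
    (hz : z ∈ K.infoDivSet) (hz' : z' ∈ K.infoDivSet) (hR : R ≤ a * z.1 + (1 - a) * z'.1) :
    a * z.2 + (1 - a) * z'.2 ≤ K.J R := by
  obtain ⟨c, hc⟩ := (K.isCompact_infoDivSet.image continuous_snd).bddAbove
  have hc' : ∀ φ ∈ stdSimplex ℝ X, ∀ x, K.klTo (K.outDist φ) x ≤ c := fun φ hφ x =>
    hc ⟨_, ⟨φ, hφ, x, rfl⟩, rfl⟩
  obtain ⟨φ, hφ, x, rfl⟩ := hz
  obtain ⟨φ', hφ', x', rfl⟩ := hz'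
  refine le_csSup ⟨c, ?_⟩ ⟨a, x, x', φ, φ', ha0, ha1, hφ, hφ', hR, rfl⟩
  rintro _ ⟨b, u, u', θ, θ', hb0, hb1, hθ, hθ', -, rfl⟩
  nlinarith [hc' θ hθ u, hc' θ' hθ' u']

/-- Jensen's inequality for `J`: two points of the set of pairs of a mutual information and a
divergence dominate any mean of points dominated by that set. -/
theorem integral_le_mul_J [Fintype X] (K : DMC X Y) {α : Type*} [MeasurableSpace α] (ν : Measure α)
    [IsFiniteMeasure ν] {f g : α → ℝ} (hf : Integrable f ν) (hg : Integrable g ν)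
    (h : ∀ᵐ s ∂ν, ∃ φ ∈ stdSimplex ℝ X, ∃ x, f s ≤ K.mutualInfo φ ∧
      g s ≤ K.klTo (K.outDist φ) x) :
    ∫ s, g s ∂ν ≤ ν.real Set.univ * K.J ((∫ s, f s ∂ν) / ν.real Set.univ) := by
  rcases eq_zero_or_neZero ν with rfl | hν
  · simp
  have hpos : 0 < ν.real Set.univ := by
    simpa [measureReal_def, ENNReal.toReal_pos_iff, measure_lt_top] using NeZero.pos (ν Set.univ)
  obtain ⟨a, ha0, ha1, z, hz, z', hz', hle⟩ := exists_two_point_dominating_average ν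
    K.isCompact_infoDivSet (hf.prodMk hg)
    (h.mono fun s ⟨φ, hφ, x, h1, h2⟩ => ⟨_, ⟨φ, hφ, x, rfl⟩, Prod.mk_le_mk.2 ⟨h1, h2⟩⟩)
  rw [average_eq, integral_pair hf hg] at hle
  have h1 := hle.1
  have h2 := hle.2
  simp only [Prod.smul_fst, Prod.smul_snd, Prod.fst_add, Prod.snd_add, smul_eq_mul] at h1 h2
  have := h2.trans (K.le_J (R := (∫ s, f s ∂ν) / ν.real Set.univ) ha0 ha1 hz hz'
    (by rw [div_eq_inv_mul]; exact h1))
  rw [inv_mul_le_iff₀ hpos] at this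
  exact this

/-- Convexity of the divergence in its second argument: the divergence from a mixture of rows
of the channel is at most the divergence from one of these rows. -/
theorem exists_sum_mul_log_le_klTo {M : Type*} [Fintype M] (K : DMC X Y) {q : Y → ℝ}
    (hq : ∀ y, 0 < q y) (e : M → X) {π : M → ℝ} (hπ : ∀ m, 0 ≤ π m) (hπ1 : ∑ m, π m = 1) :
    ∃ x, ∑ y, q y * Real.log (q y / ∑ m, π m * K.W (e m) y) ≤ K.klTo q x := by
  obtain ⟨m, hm⟩ : ∃ m, ∑ m, π m * K.klTo q (e m) ≤ K.klTo q (e m) := by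
    by_contra! h
    have h1 : ∑ m, π m * K.klTo q (e m) < ∑ m, π m * ∑ m, π m * K.klTo q (e m) := by
      refine Finset.sum_lt_sum (fun m _ => mul_le_mul_of_nonneg_left (h m).le (hπ m)) ?_
      by_contra! h'
      have : ∀ m, π m = 0 := fun m => by
        by_contra hne
        exact absurd (h' m (Finset.mem_univ m))
          (not_le.2 (mul_lt_mul_of_pos_left (h m) (lt_of_le_of_ne (hπ m) (Ne.symm hne))))
      simp [this] at hπ1
    rw [← Finset.sum_mul, hπ1, one_mul] at h1
    exact lt_irrefl _ h1
  refine ⟨e m, le_trans ?_ hm⟩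
  simp only [klTo, Finset.mul_sum]
  rw [Finset.sum_comm]
  refine Finset.sum_le_sum fun y _ => ?_
  have hmix : 0 < ∑ m, π m * K.W (e m) y := by
    obtain ⟨m, hm⟩ : ∃ m, π m ≠ 0 := by
      by_contra! h
      simp [h] at hπ1
    exact Finset.sum_pos' (fun m _ => mul_nonneg (hπ m) (K.pos _ y).le)
      ⟨m, Finset.mem_univ m, mul_pos (lt_of_le_of_ne (hπ m) hm.symm) (K.pos _ y)⟩
  have hJ : ∑ m, π m * Real.log (K.W (e m) y) ≤ Real.log (∑ m, π m * K.W (e m) y) := by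
    simpa using strictConcaveOn_log_Ioi.concaveOn.le_map_sum (t := Finset.univ) (w := π)
      (p := fun m => K.W (e m) y) (fun m _ => hπ m) hπ1 (fun m _ => K.pos _ y)
  have hR : ∑ m, π m * (q y * Real.log (q y / K.W (e m) y)) =
      q y * (Real.log (q y) - ∑ m, π m * Real.log (K.W (e m) y)) := by
    have : ∀ m, π m * (q y * Real.log (q y / K.W (e m) y)) =
        q y * (π m * Real.log (q y) - π m * Real.log (K.W (e m) y)) := fun m => by
      rw [Real.log_div (hq y).ne' (K.pos _ y).ne']; ring
    simp only [this]
    rw [← Finset.mul_sum, Finset.sum_sub_distrib, ← Finset.sum_mul, hπ1, one_mul]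
  rw [hR, Real.log_div (hq y).ne' hmix.ne']
  exact mul_le_mul_of_nonneg_left (by linarith) (hq y).le

/-- A common positive lower bound for the transition probabilities. -/
theorem exists_pos_le_W [Fintype X] (K : DMC X Y) : ∃ c, 0 < c ∧ c ≤ 1 ∧ ∀ x y, c ≤ K.W x y := by
  obtain ⟨c, hc⟩ := (Set.finite_range fun p : X × Y => max 1 (K.W p.1 p.2)⁻¹).bddAbove
  have h : ∀ x y, max 1 (K.W x y)⁻¹ ≤ max 1 c := fun x y =>
    (hc ⟨(x, y), rfl⟩).trans (le_max_right _ _)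
  refine ⟨(max 1 c)⁻¹, by positivity, inv_le_one_of_one_le₀ (le_max_left _ _), fun x y => ?_⟩
  exact inv_le_of_inv_le₀ (K.pos x y) ((le_max_right _ _).trans (h x y))

theorem W_le_one (K : DMC X Y) (x : X) (y : Y) : K.W x y ≤ 1 := by
  rw [← K.sum_one x]
  exact Finset.single_le_sum (fun y _ => (K.pos x y).le) (Finset.mem_univ y)

end DMC

/-! ### Output strings and Markov times -/

section Strings

variable {Y : Type*}

@[simp]
theorem length_firstLetters (y : ℕ → Y) (n : ℕ) : (firstLetters y n).length = n := by
  simp [firstLetters]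

theorem firstLetters_succ (y : ℕ → Y) (n : ℕ) :
    firstLetters y (n + 1) = firstLetters y n ++ [y n] := by
  simp [firstLetters, List.range_succ]

theorem take_firstLetters (y : ℕ → Y) {m n : ℕ} (h : m ≤ n) :
    (firstLetters y n).take m = firstLetters y m := by
  simp [firstLetters, ← List.map_take, List.take_range, h]

theorem firstLetters_congr_of_le {y y' : ℕ → Y} {m n : ℕ} (h : m ≤ n)
    (hn : firstLetters y n = firstLetters y' n) : firstLetters y m = firstLetters y' m := by
  rw [← take_firstLetters y h, hn, take_firstLetters y' h]

/-- The infinite sequence that continues the string `s` by a fixed letter. -/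
noncomputable def padded [Nonempty Y] (s : List Y) : ℕ → Y :=
  fun t => s.getD t (Classical.arbitrary Y)

@[simp]
theorem firstLetters_padded [Nonempty Y] (s : List Y) :
    firstLetters (padded s) s.length = s := by
  apply List.ext_getElem (by simp)
  intro i h1 h2
  simp [firstLetters, padded, h2]

theorem length_upTo (T : (ℕ → Y) → ℕ∞) (y : ℕ → Y) : (upTo T y).length = (T y).toNat := by
  simp [upTo]

theorem upTo_of_eq {T : (ℕ → Y) → ℕ∞} {y : ℕ → Y} {n : ℕ} (h : T y = n) :
    upTo T y = firstLetters y n := by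
  simp [upTo, h]

namespace IsMarkovTime

variable {T T' : (ℕ → Y) → ℕ∞}

theorem eq_of_le (hT : IsMarkovTime T) {y y' : ℕ → Y} {n : ℕ}
    (h : firstLetters y n = firstLetters y' n) (hn : T y ≤ n) : T y' = T y := by
  lift T y to ℕ using ne_top_of_le_ne_top (ENat.natCast_ne_top n) hn with m hm
  exact hT m y y' (firstLetters_congr_of_le (by exact_mod_cast hn) h) hm.symm

theorem le_iff (hT : IsMarkovTime T) {y y' : ℕ → Y} {n : ℕ}
    (h : firstLetters y n = firstLetters y' n) : T y ≤ n ↔ T y' ≤ n :=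
  ⟨fun hn => (hT.eq_of_le h hn).trans_le hn, fun hn => (hT.eq_of_le h.symm hn).trans_le hn⟩

theorem mem_stoppedStrings (hT : IsMarkovTime T) {y : ℕ → Y} {n : ℕ} (h : T y = n) :
    firstLetters y n ∈ stoppedStrings T := fun y' hy' => by
  rw [length_firstLetters] at hy' ⊢
  exact hT n y y' hy'.symm h

theorem upTo_mem_stoppedStrings (hT : IsMarkovTime T) {y : ℕ → Y} (h : T y < ⊤) :
    upTo T y ∈ stoppedStrings T := by
  lift T y to ℕ using h.ne with n hn
  rw [upTo_of_eq hn.symm]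
  exact hT.mem_stoppedStrings hn.symm

/-- A string that reaches `T` is cut at `T` where the sequence itself is cut. -/
theorem cutAt_firstLetters [Nonempty Y] (hT : IsMarkovTime T) {y : ℕ → Y} {n : ℕ}
    (h : T y ≤ n) : cutAt T (firstLetters y n) = upTo T y := by
  have h1 : T (padded (firstLetters y n)) = T y := by
    refine hT.eq_of_le (n := n) ?_ h
    conv_rhs => rw [← length_firstLetters y n, length_firstLetters y n]
    simpa using (firstLetters_padded (firstLetters y n)).symm
  change (firstLetters y n).take (T (padded (firstLetters y n))).toNat = _
  rw [h1, upTo, take_firstLetters]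
  exact ENat.toNat_le_of_le_natCast h

theorem cutAt_upTo [Nonempty Y] (hT : IsMarkovTime T) {y : ℕ → Y} (h : T y ≤ T' y)
    (h' : T' y < ⊤) : cutAt T (upTo T' y) = upTo T y := by
  apply hT.cutAt_firstLetters
  rwa [ENat.natCast_toNat h'.ne]

end IsMarkovTime

/-- Strings carry the discrete measurable structure. -/
instance List.instMeasurableSpaceDiscrete : MeasurableSpace (List Y) := ⊤

instance List.instDiscreteMeasurableSpaceDiscrete : DiscreteMeasurableSpace (List Y) :=
  ⟨fun _ => trivial⟩

end Strings

/-- If the event `B` has conditional probability `κ s` given `Z = s`, then the law of `Z` on `B` has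
the density `κ` with respect to the law of `Z`. -/
theorem map_restrict_eq_withDensity {Ω α : Type*} [MeasurableSpace Ω] [MeasurableSpace α]
    [Countable α] [MeasurableSingletonClass α] (μ : Measure Ω) {Z : Ω → α} (hZ : Measurable Z)
    (B : Set Ω) (κ : α → NNReal)
    (h : ∀ s, μ (B ∩ Z ⁻¹' {s}) = κ s * μ (Z ⁻¹' {s})) :
    (μ.restrict B).map Z = (μ.map Z).withDensity fun s => (κ s : ENNReal) := by
  refine Measure.ext_of_singleton fun s => ?_
  rw [Measure.map_apply hZ (measurableSet_singleton s),
    Measure.restrict_apply (hZ (measurableSet_singleton s)), Set.inter_comm, h,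
    withDensity_apply _ (measurableSet_singleton s), lintegral_singleton,
    Measure.map_apply hZ (measurableSet_singleton s)]

namespace CodeProcess

variable {X Y M : Type*} [Fintype Y] [Fintype M] {K : DMC X Y} {C : VLCode X Y M}
  {Ω : Type*} [MeasurableSpace Ω]

instance (P : CodeProcess K C Ω) : IsProbabilityMeasure P.μ := P.prob

theorem nonempty_mes (P : CodeProcess K C Ω) : Nonempty M :=
  (nonempty_of_isProbabilityMeasure P.μ).map P.mes

theorem measurable_firstLetters (P : CodeProcess K C Ω) (t : ℕ) :
    Measurable fun ω => firstLetters (P.out ω) t := by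
  induction t with
  | zero => simp [firstLetters]
  | succ t ih =>
    refine measurable_to_countable' fun s => ?_
    rcases List.eq_nil_or_concat s with rfl | ⟨s, y, rfl⟩
    · convert MeasurableSet.empty
      ext ω
      simp [firstLetters_succ]
    · convert (ih (measurableSet_singleton s)).inter (P.measurable_out t y) using 1
      ext ω
      simp [firstLetters_succ]

theorem measurableSet_firstLetters (P : CodeProcess K C Ω) (s : List Y) :
    MeasurableSet {ω | firstLetters (P.out ω) s.length = s} :=
  P.measurable_firstLetters s.length (measurableSet_singleton s)

/-! ### Law of the process -/

theorem pOut_eq_sum (P : CodeProcess K C Ω) (s : List Y) : P.pOut s = ∑ m, P.pJoint m s := by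
  unfold pOut pJoint
  rw [← measureReal_biUnion_finset]
  · congr 1
    ext ω
    simp
  · intro m _ m' _ hne
    exact Set.disjoint_left.2 fun ω h h' => hne (h.1.symm.trans h'.1)
  · exact fun m _ => (P.measurable_mes m).inter (P.measurableSet_firstLetters s)

theorem pJoint_append (P : CodeProcess K C Ω) (m : M) (s : List Y) (y : Y) :
    P.pJoint m (s ++ [y]) = P.pJoint m s * K.W (C.enc m s) y := by
  unfold pJoint
  rw [← P.channel]
  simp

theorem pJoint_pos (P : CodeProcess K C Ω) (m : M) (s : List Y) : 0 < P.pJoint m s := by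
  have := P.nonempty_mes
  induction s using List.reverseRecOn with
  | nil =>
    have h : P.pJoint m [] = 1 / (Fintype.card M : ℝ) := by
      rw [← P.uniform m]
      simp [pJoint, firstLetters]
    rw [h]
    have := Fintype.card_pos (α := M)
    positivity
  | append_singleton s y ih =>
    rw [pJoint_append]
    exact mul_pos ih (K.pos _ _)

theorem pOut_pos (P : CodeProcess K C Ω) (s : List Y) : 0 < P.pOut s := by
  have := P.nonempty_mes
  rw [pOut_eq_sum]
  exact Finset.sum_pos (fun m _ => P.pJoint_pos m s) Finset.univ_nonempty

theorem posterior_pos (P : CodeProcess K C Ω) (m : M) (s : List Y) : 0 < P.posterior m s :=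
  div_pos (P.pJoint_pos m s) (P.pOut_pos s)

theorem sum_posterior (P : CodeProcess K C Ω) (s : List Y) : ∑ m, P.posterior m s = 1 := by
  unfold posterior
  rw [← Finset.sum_div, ← pOut_eq_sum, div_self (P.pOut_pos s).ne']

theorem posterior_le_one (P : CodeProcess K C Ω) (m : M) (s : List Y) : P.posterior m s ≤ 1 := by
  rw [← P.sum_posterior s]
  exact Finset.single_le_sum (fun m _ => (P.posterior_pos m s).le) (Finset.mem_univ m)

theorem pOut_append (P : CodeProcess K C Ω) (s : List Y) (y : Y) :
    P.pOut (s ++ [y]) = ∑ m, P.pJoint m s * K.W (C.enc m s) y := by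
  simp only [pOut_eq_sum, pJoint_append]

/-- The probability that the next output is `y` given that the outputs start with `s`. -/
noncomputable def pNext (P : CodeProcess K C Ω) (s : List Y) (y : Y) : ℝ :=
  P.pOut (s ++ [y]) / P.pOut s

theorem pNext_pos (P : CodeProcess K C Ω) (s : List Y) (y : Y) : 0 < P.pNext s y :=
  div_pos (P.pOut_pos _) (P.pOut_pos _)

theorem pNext_eq_sum (P : CodeProcess K C Ω) (s : List Y) (y : Y) :
    P.pNext s y = ∑ m, P.posterior m s * K.W (C.enc m s) y := by
  unfold pNext posterior
  rw [pOut_append, Finset.sum_div]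
  exact Finset.sum_congr rfl fun m _ => by ring

theorem sum_pNext (P : CodeProcess K C Ω) (s : List Y) : ∑ y, P.pNext s y = 1 := by
  simp only [pNext_eq_sum]
  rw [Finset.sum_comm]
  simp only [← Finset.mul_sum, K.sum_one, mul_one, sum_posterior]

/-- The expected increment of `g` along the output sequence when the outputs so far are `s`. -/
noncomputable def drift (P : CodeProcess K C Ω) (g : List Y → ℝ) (s : List Y) : ℝ :=
  ∑ y, P.pNext s y * (g (s ++ [y]) - g s)

theorem abs_drift_le (P : CodeProcess K C Ω) {g : List Y → ℝ} {c : ℝ}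
    (hg : ∀ s y, |g (s ++ [y]) - g s| ≤ c) (s : List Y) : |P.drift g s| ≤ c := by
  unfold drift
  refine (Finset.abs_sum_le_sum_abs _ _).trans ?_
  calc ∑ y, |P.pNext s y * (g (s ++ [y]) - g s)| ≤ ∑ y, P.pNext s y * c :=
        Finset.sum_le_sum fun y _ => by
          rw [abs_mul, abs_of_pos (P.pNext_pos s y)]
          exact mul_le_mul_of_nonneg_left (hg s y) (P.pNext_pos s y).le
    _ = c := by rw [← Finset.sum_mul, sum_pNext, one_mul]

theorem measure_out_inter (P : CodeProcess K C Ω) (t : ℕ) (y : Y) (s : List Y) :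
    P.μ ({ω | P.out ω t = y} ∩ (fun ω => firstLetters (P.out ω) t) ⁻¹' {s}) =
      ((P.pNext s y).toNNReal : ENNReal) *
        P.μ ((fun ω => firstLetters (P.out ω) t) ⁻¹' {s}) := by
  by_cases hs : s.length = t
  · subst hs
    have h1 : {ω | P.out ω s.length = y} ∩ (fun ω => firstLetters (P.out ω) s.length) ⁻¹' {s} =
        {ω | firstLetters (P.out ω) (s ++ [y]).length = s ++ [y]} := by
      ext ω
      simp [firstLetters_succ, and_comm]
    have h2 : ∀ s, P.μ {ω | firstLetters (P.out ω) s.length = s} = ENNReal.ofReal (P.pOut s) :=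
      fun s => by simp [pOut]
    have h3 : (fun ω => firstLetters (P.out ω) s.length) ⁻¹' {s} =
        {ω | firstLetters (P.out ω) s.length = s} := rfl
    rw [h1, h3, h2, h2]
    change _ = ENNReal.ofReal (P.pNext s y) * _
    rw [← ENNReal.ofReal_mul (P.pNext_pos s y).le, pNext, div_mul_cancel₀ _ (P.pOut_pos s).ne']
  · have : (fun ω => firstLetters (P.out ω) t) ⁻¹' {s} = ∅ := by
      ext ω
      simp only [Set.mem_preimage, Set.mem_singleton_iff, Set.mem_empty_iff_false, iff_false]
      rintro rfl
      simp at hs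
    simp [this]

/-- The next output may be averaged out given the outputs so far. -/
theorem integral_next (P : CodeProcess K C Ω) (t : ℕ) (H : List Y → Y → ℝ) {c : ℝ}
    (hH : ∀ s y, |H s y| ≤ c) :
    ∫ ω, H (firstLetters (P.out ω) t) (P.out ω t) ∂P.μ =
      ∫ ω, ∑ y, P.pNext (firstLetters (P.out ω) t) y * H (firstLetters (P.out ω) t) y ∂P.μ := by
  classical
  have hZ := P.measurable_firstLetters t
  have hmeas : ∀ f : List Y → ℝ, AEStronglyMeasurable (fun ω => f (firstLetters (P.out ω) t)) P.μ :=
    fun f => ((measurable_of_countable f).comp hZ).aestronglyMeasurable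
  have hint : ∀ y, Integrable (fun ω => H (firstLetters (P.out ω) t) y) P.μ := fun y =>
    Integrable.of_bound (hmeas fun s => H s y) c (ae_of_all _ fun ω => hH _ y)
  have hsplit : ∀ ω, H (firstLetters (P.out ω) t) (P.out ω t) =
      ∑ y, Set.indicator {ω | P.out ω t = y} (fun ω => H (firstLetters (P.out ω) t) y) ω := by
    intro ω
    simp [Set.indicator_apply]
  simp only [hsplit]
  rw [integral_finsetSum _ fun y _ => (hint y).indicator (P.measurable_out t y),
    integral_finsetSum _ fun y _ => ?_]
  · refine Finset.sum_congr rfl fun y _ => ?_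
    rw [integral_indicator (P.measurable_out t y)]
    have h1 := map_restrict_eq_withDensity P.μ hZ _ _ (P.measure_out_inter t y)
    have h2 := congrArg (fun ν => ∫ s, H s y ∂ν) h1
    rw [integral_map hZ.aemeasurable (measurable_of_countable _).aestronglyMeasurable,
      integral_withDensity_eq_integral_smul (measurable_of_countable _),
      integral_map hZ.aemeasurable (measurable_of_countable _).aestronglyMeasurable] at h2
    rw [h2]
    refine integral_congr_ae (ae_of_all _ fun ω => ?_)
    simp [NNReal.smul_def, (P.pNext_pos _ y).le]
  · refine Integrable.of_bound (hmeas fun s => P.pNext s y * H s y) c (ae_of_all _ fun ω => ?_)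
    have h1 : P.pNext (firstLetters (P.out ω) t) y ≤ 1 := by
      rw [← P.sum_pNext (firstLetters (P.out ω) t)]
      exact Finset.single_le_sum (fun y _ => (P.pNext_pos _ y).le) (Finset.mem_univ y)
    rw [Real.norm_eq_abs, abs_mul, abs_of_pos (P.pNext_pos _ _)]
    exact (mul_le_of_le_one_left (abs_nonneg _) h1).trans (hH _ _)

end CodeProcess

theorem abs_sub_firstLetters_le {Y : Type*} {g : List Y → ℝ} {c : ℝ}
    (hg : ∀ s y, |g (s ++ [y]) - g s| ≤ c) (y : ℕ → Y) {m n : ℕ} (hmn : m ≤ n) :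
    |g (firstLetters y n) - g (firstLetters y m)| ≤ c * (n - m) := by
  induction n, hmn using Nat.le_induction with
  | base => simp
  | succ n _ ih =>
    have := hg (firstLetters y n) (y n)
    rw [← firstLetters_succ] at this
    push_cast
    calc _ = |(g (firstLetters y (n + 1)) - g (firstLetters y n)) +
          (g (firstLetters y n) - g (firstLetters y m))| := by ring_nf
      _ ≤ _ := abs_add_le _ _
      _ ≤ _ := by linarith

namespace CodeProcess

variable {X Y M : Type*} [Fintype Y] [Fintype M] {K : DMC X Y} {C : VLCode X Y M}
  {Ω : Type*} [MeasurableSpace Ω]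

/-! ### Occupation measures and the optional stopping formula -/

theorem measurableSet_time_eq (P : CodeProcess K C Ω) {T : (ℕ → Y) → ℕ∞} (hT : IsMarkovTime T)
    (n : ℕ) : MeasurableSet {ω | T (P.out ω) = n} := by
  have h : {ω | T (P.out ω) = n} = (fun ω => firstLetters (P.out ω) n) ⁻¹'
      {s | ∃ y, firstLetters y n = s ∧ T y = n} := by
    ext ω
    exact ⟨fun h => ⟨_, rfl, h⟩, fun ⟨y, hy, h⟩ => hT n y _ hy h⟩
  rw [h]
  exact P.measurable_firstLetters n trivial

theorem measurable_upTo (P : CodeProcess K C Ω) {T : (ℕ → Y) → ℕ∞} (hT : IsMarkovTime T) :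
    Measurable fun ω => upTo T (P.out ω) := by
  refine measurable_to_countable' fun s => ?_
  -- where `T` is infinite, `upTo T` is the empty string
  have h : (fun ω => upTo T (P.out ω)) ⁻¹' {s} =
      (⋃ n : ℕ, {ω | T (P.out ω) = n} ∩ (fun ω => firstLetters (P.out ω) n) ⁻¹' {s}) ∪
        ((⋃ n : ℕ, {ω | T (P.out ω) = n})ᶜ ∩ {_ω | [] = s}) := by
    ext ω
    rcases eq_or_ne (T (P.out ω)) ⊤ with h | h
    · simp [h, upTo, firstLetters]
    · lift T (P.out ω) to ℕ using h with n hn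
      simp [upTo_of_eq hn.symm, ← hn]
  rw [h]
  refine .union (.iUnion fun n => (P.measurableSet_time_eq hT n).inter
    (P.measurable_firstLetters n (measurableSet_singleton s))) ?_
  exact (MeasurableSet.iUnion fun n => P.measurableSet_time_eq hT n).compl.inter (.const _)

/-- The outputs for which time `t` falls between `T` (inclusive) and `T'` (exclusive). -/
def running (P : CodeProcess K C Ω) (T T' : (ℕ → Y) → ℕ∞) (t : ℕ) : Set Ω :=
  {ω | T (P.out ω) ≤ t ∧ t < T' (P.out ω)}

theorem running_eq_preimage (P : CodeProcess K C Ω) {T T' : (ℕ → Y) → ℕ∞} (hT : IsMarkovTime T)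
    (hT' : IsMarkovTime T') (t : ℕ) : P.running T T' t = (fun ω => firstLetters (P.out ω) t) ⁻¹'
      {s | (∃ y, firstLetters y t = s ∧ T y ≤ t) ∧ ∀ y, firstLetters y t = s → ¬ T' y ≤ t} := by
  ext ω
  simp only [running, ← not_le]
  exact ⟨fun h => ⟨⟨_, rfl, h.1⟩, fun y hy h' => h.2 ((hT'.le_iff hy).1 h')⟩,
    fun ⟨⟨y, hy, h⟩, h'⟩ => ⟨(hT.le_iff hy).1 h, h' _ rfl⟩⟩

theorem measurableSet_running (P : CodeProcess K C Ω) {T T' : (ℕ → Y) → ℕ∞}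
    (hT : IsMarkovTime T) (hT' : IsMarkovTime T') (t : ℕ) : MeasurableSet (P.running T T' t) := by
  rw [P.running_eq_preimage hT hT']
  exact P.measurable_firstLetters t trivial

/-- The occupation measure of the output strings at the times from `T` to `T'`: the mass of `s` is
the probability that the outputs start with `s` and that the time `s.length` falls between `T`
(inclusive) and `T'` (exclusive). -/
noncomputable def occupation (P : CodeProcess K C Ω) (T T' : (ℕ → Y) → ℕ∞) : Measure (List Y) :=
  Measure.sum fun t : ℕ =>
    (P.μ.restrict (P.running T T' t)).map fun ω => firstLetters (P.out ω) t

theorem tsum_measure_running_le (P : CodeProcess K C Ω) {T T' : (ℕ → Y) → ℕ∞}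
    (hT : IsMarkovTime T) (hT' : IsMarkovTime T')
    (hle' : ∀ᵐ ω ∂P.μ, T' (P.out ω) ≤ C.time (P.out ω)) :
    ∑' t, P.μ (P.running T T' t) ≤ ∫⁻ ω, (C.time (P.out ω) : ENNReal) ∂P.μ := by
  have h1 : ∀ t, P.μ (P.running T T' t) = ∫⁻ ω, (P.running T T' t).indicator 1 ω ∂P.μ := fun t =>
    (lintegral_indicator_one (P.measurableSet_running hT hT' t)).symm
  simp only [h1]
  rw [← lintegral_tsum fun t =>
    (measurable_one.indicator (P.measurableSet_running hT hT' t)).aemeasurable]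
  refine lintegral_mono_ae (hle'.mono fun ω hω => ?_)
  refine le_trans ?_ (ENat.toENNReal_le.2 hω)
  rcases eq_or_ne (T' (P.out ω)) ⊤ with h | h
  · simp [h]
  · lift T' (P.out ω) to ℕ using h with n hn
    rw [tsum_eq_sum (s := Finset.range n) fun t ht => ?_]
    · refine (Finset.sum_le_sum (g := fun _ => 1)
        fun t _ => Set.indicator_le_self' (by simp) ω).trans ?_
      simp
    · refine Set.indicator_of_notMem (fun h => ht ?_) _
      simpa [← hn] using h.2

theorem isFiniteMeasure_occupation (P : CodeProcess K C Ω)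
    (hfin : ∫⁻ ω, (C.time (P.out ω) : ENNReal) ∂P.μ < ⊤) {T T' : (ℕ → Y) → ℕ∞}
    (hT : IsMarkovTime T) (hT' : IsMarkovTime T')
    (hle' : ∀ᵐ ω ∂P.μ, T' (P.out ω) ≤ C.time (P.out ω)) :
    IsFiniteMeasure (P.occupation T T') := by
  refine ⟨lt_of_le_of_lt ?_ hfin⟩
  refine le_trans (le_of_eq ?_) (P.tsum_measure_running_le hT hT' hle')
  rw [occupation, Measure.sum_apply _ .univ]
  refine tsum_congr fun t => ?_
  rw [Measure.map_apply (P.measurable_firstLetters t) .univ]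
  simp

theorem integrable_sub_upTo (P : CodeProcess K C Ω)
    (hfin : ∫⁻ ω, (C.time (P.out ω) : ENNReal) ∂P.μ < ⊤) {T T' : (ℕ → Y) → ℕ∞}
    (hT : IsMarkovTime T) (hT' : IsMarkovTime T')
    (hle : ∀ᵐ ω ∂P.μ, T (P.out ω) ≤ T' (P.out ω))
    (hle' : ∀ᵐ ω ∂P.μ, T' (P.out ω) ≤ C.time (P.out ω))
    {g : List Y → ℝ} {c : ℝ} (hg : ∀ s y, |g (s ++ [y]) - g s| ≤ c) :
    Integrable (fun ω => g (upTo T' (P.out ω)) - g (upTo T (P.out ω))) P.μ := by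
  refine ⟨(((measurable_of_countable g).comp (P.measurable_upTo hT')).sub
    ((measurable_of_countable g).comp (P.measurable_upTo hT))).aestronglyMeasurable, ?_⟩
  refine lt_of_le_of_lt ?_ (ENNReal.mul_lt_top (a := ENNReal.ofReal |c|) ENNReal.ofReal_lt_top hfin)
  rw [← lintegral_const_mul' _ _ ENNReal.ofReal_ne_top]
  refine lintegral_mono_ae ?_
  filter_upwards [hle, hle', P.time_finite] with ω h h' hlt
  lift C.time (P.out ω) to ℕ using hlt.ne with N hN
  lift T' (P.out ω) to ℕ using ne_top_of_le_ne_top (ENat.natCast_ne_top _) h' with n hn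
  lift T (P.out ω) to ℕ using ne_top_of_le_ne_top (ENat.natCast_ne_top _) h with m hm
  rw [upTo_of_eq hn.symm, upTo_of_eq hm.symm, ← ofReal_norm, Real.norm_eq_abs]
  norm_cast at h h'
  rw [ENat.toENNReal_coe, ← ENNReal.ofReal_natCast, ← ENNReal.ofReal_mul (abs_nonneg _)]
  refine ENNReal.ofReal_le_ofReal ((abs_sub_firstLetters_le hg _ h).trans ?_)
  have h1 : (m : ℝ) ≤ n := by exact_mod_cast h
  have h2 : (n : ℝ) ≤ N := by exact_mod_cast h'
  calc c * (n - m) ≤ |c| * (n - m) := mul_le_mul_of_nonneg_right (le_abs_self c) (by linarith)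
    _ ≤ |c| * N := mul_le_mul_of_nonneg_left
      (by linarith [(Nat.cast_nonneg m : (0 : ℝ) ≤ m)]) (abs_nonneg c)

/-- Optional stopping: the expected change of `g` between two Markov times is the integral of the
drift of `g` over the output strings met in between. -/
theorem integral_sub_upTo (P : CodeProcess K C Ω)
    (hfin : ∫⁻ ω, (C.time (P.out ω) : ENNReal) ∂P.μ < ⊤) {T T' : (ℕ → Y) → ℕ∞}
    (hT : IsMarkovTime T) (hT' : IsMarkovTime T')
    (hle : ∀ᵐ ω ∂P.μ, T (P.out ω) ≤ T' (P.out ω))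
    (hle' : ∀ᵐ ω ∂P.μ, T' (P.out ω) ≤ C.time (P.out ω))
    {g : List Y → ℝ} {c : ℝ} (hg : ∀ s y, |g (s ++ [y]) - g s| ≤ c) :
    ∫ ω, (g (upTo T' (P.out ω)) - g (upTo T (P.out ω))) ∂P.μ =
      ∫ s, P.drift g s ∂P.occupation T T' := by
  classical
  have := P.isFiniteMeasure_occupation hfin hT hT' hle'
  set D := P.running T T' with hD
  have hDm : ∀ t, MeasurableSet (D t) := P.measurableSet_running hT hT'
  let F : ℕ → Ω → ℝ := fun t => (D t).indicator fun ω =>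
    g (firstLetters (P.out ω) (t + 1)) - g (firstLetters (P.out ω) t)
  have hbound : ∀ t ω, ‖g (firstLetters (P.out ω) (t + 1)) - g (firstLetters (P.out ω) t)‖ ≤ c :=
    fun t ω => by
      rw [firstLetters_succ]
      exact hg _ _
  have hmeas : ∀ t, AEStronglyMeasurable (fun ω =>
      g (firstLetters (P.out ω) (t + 1)) - g (firstLetters (P.out ω) t)) P.μ := fun t =>
    (((measurable_of_countable g).comp (P.measurable_firstLetters (t + 1))).sub
      ((measurable_of_countable g).comp (P.measurable_firstLetters t))).aestronglyMeasurable
  have hFint : ∀ t, Integrable (F t) P.μ := fun t =>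
    (Integrable.of_bound (hmeas t) c (ae_of_all _ (hbound t))).indicator (hDm t)
  have hsumD : Summable fun t => P.μ.real (D t) := ENNReal.summable_toReal
    ((P.tsum_measure_running_le hT hT' hle').trans_lt hfin).ne
  have hFsum : Summable fun t => ∫ ω, ‖F t ω‖ ∂P.μ := by
    refine Summable.of_nonneg_of_le (fun t => integral_nonneg fun ω => norm_nonneg _) (fun t => ?_)
      (hsumD.mul_right c)
    calc ∫ ω, ‖F t ω‖ ∂P.μ ≤ ∫ ω, (D t).indicator (fun _ => c) ω ∂P.μ := by
          refine integral_mono (hFint t).norm ((integrable_const c).indicator (hDm t)) fun ω => ?_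
          simp only [F, norm_indicator_eq_indicator_norm]
          exact Set.indicator_le_indicator (hbound t ω)
      _ = P.μ.real (D t) * c := by rw [integral_indicator_const _ (hDm t), smul_eq_mul]
  -- both sides are series over the time `t`, and they agree termwise
  have h1 := hasSum_integral_of_summable_integral_norm hFint hFsum
  have h2 : HasSum (fun t => ∫ s, P.drift g s ∂((P.μ.restrict (D t)).map
      fun ω => firstLetters (P.out ω) t)) (∫ s, P.drift g s ∂P.occupation T T') := by
    have hi : Integrable (P.drift g) (P.occupation T T') := Integrable.of_bound
      (measurable_of_countable _).aestronglyMeasurable c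
      (ae_of_all _ fun s => P.abs_drift_le hg s)
    exact hasSum_integral_measure hi
  have h3 : ∀ t, ∫ ω, F t ω ∂P.μ = ∫ s, P.drift g s ∂((P.μ.restrict (D t)).map
      fun ω => firstLetters (P.out ω) t) := by
    intro t
    rw [integral_map (P.measurable_firstLetters t).aemeasurable
      (measurable_of_countable _).aestronglyMeasurable, ← integral_indicator (hDm t)]
    obtain ⟨B, hB⟩ : ∃ B, D t = (fun ω => firstLetters (P.out ω) t) ⁻¹' B :=
      ⟨_, P.running_eq_preimage hT hT' t⟩
    have hBD : ∀ (f : Ω → ℝ) (ω : Ω), (D t).indicator f ω =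
        if firstLetters (P.out ω) t ∈ B then f ω else 0 := fun f ω => by
      rw [hB, Set.indicator_apply]
      simp only [Set.mem_preimage]
    have h4 := P.integral_next t (fun s y => if s ∈ B then g (s ++ [y]) - g s else 0) (c := c)
      fun s y => by
        split_ifs
        · exact hg s y
        · simpa using (abs_nonneg _).trans (hg s y)
    simp only [F, hBD, firstLetters_succ]
    rw [h4]
    refine integral_congr_ae (ae_of_all _ fun ω => ?_)
    by_cases h : firstLetters (P.out ω) t ∈ B <;> simp [h, drift]
  simp only [h3] at h1
  rw [← h1.unique h2]
  refine integral_congr_ae ?_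
  filter_upwards [hle, hle', P.time_finite] with ω h h' hlt
  have hlt' : T' (P.out ω) < ⊤ := h'.trans_lt hlt
  lift T' (P.out ω) to ℕ using hlt'.ne with n hn
  lift T (P.out ω) to ℕ using ne_top_of_le_ne_top (ENat.natCast_ne_top _) h with m hm
  have hmem : ∀ t, ω ∈ D t ↔ t ∈ Finset.Ico m n := fun t => by
    simp only [hD, running, Finset.mem_Ico, ← Nat.cast_le (α := ℕ∞), ← Nat.cast_lt (α := ℕ∞)]
    rw [hn, hm]
    rfl
  -- the sum of the increments telescopes
  rw [upTo_of_eq hn.symm, upTo_of_eq hm.symm, tsum_eq_sum (s := Finset.Ico m n) fun t ht =>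
    Set.indicator_of_notMem (fun h => ht ((hmem t).1 h)) _]
  rw [Finset.sum_congr rfl fun t ht => Set.indicator_of_mem ((hmem t).2 ht) _]
  rw [Finset.sum_Ico_sub (fun t => g (firstLetters (P.out ω) t)) (by exact_mod_cast h)]

/-- The total occupation mass is the expected duration. -/
theorem real_occupation_univ (P : CodeProcess K C Ω)
    (hfin : ∫⁻ ω, (C.time (P.out ω) : ENNReal) ∂P.μ < ⊤) {T T' : (ℕ → Y) → ℕ∞}
    (hT : IsMarkovTime T) (hT' : IsMarkovTime T')
    (hle : ∀ᵐ ω ∂P.μ, T (P.out ω) ≤ T' (P.out ω))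
    (hle' : ∀ᵐ ω ∂P.μ, T' (P.out ω) ≤ C.time (P.out ω)) :
    (P.occupation T T').real Set.univ = P.expDuration T T' := by
  have := P.isFiniteMeasure_occupation hfin hT hT' hle'
  have h := P.integral_sub_upTo hfin hT hT' hle hle' (g := fun s => (s.length : ℝ)) (c := 1)
    (fun s y => by simp)
  simp only [length_upTo] at h
  rw [expDuration, h]
  simp [drift, sum_pNext]

/-! ### Drift of the conditional entropy -/

theorem abs_condEntropy_append_sub_le (P : CodeProcess K C Ω) (s : List Y) (y : Y) :
    |P.condEntropy (s ++ [y]) - P.condEntropy s| ≤ Fintype.card M := by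
  have h0 : ∀ s, 0 ≤ P.condEntropy s := fun s => Finset.sum_nonneg fun m _ =>
    Real.negMulLog_nonneg (P.posterior_pos m s).le (P.posterior_le_one m s)
  have h1 : ∀ s, P.condEntropy s ≤ Fintype.card M := fun s => by
    calc P.condEntropy s ≤ ∑ _m : M, (1 : ℝ) := Finset.sum_le_sum fun m _ => by
          have hp := P.posterior_pos m s
          have h := Real.one_sub_inv_le_log_of_pos hp
          have h' := mul_le_mul_of_nonneg_left h hp.le
          rw [mul_sub, mul_inv_cancel₀ hp.ne'] at h'
          rw [Real.negMulLog]
          linarith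
      _ = Fintype.card M := by simp
  rw [abs_le]
  constructor <;> linarith [h0 s, h1 s, h0 (s ++ [y]), h1 (s ++ [y])]

open Classical in
/-- The distribution of the next channel input given that the outputs start with `s`. -/
noncomputable def inputDist (P : CodeProcess K C Ω) (s : List Y) (x : X) : ℝ :=
  ∑ m, if C.enc m s = x then P.posterior m s else 0

theorem sum_inputDist_mul [Fintype X] (P : CodeProcess K C Ω) (s : List Y) (f : X → ℝ) :
    ∑ x, P.inputDist s x * f x = ∑ m, P.posterior m s * f (C.enc m s) := by
  classical
  simp only [inputDist, Finset.sum_mul]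
  rw [Finset.sum_comm]
  exact Finset.sum_congr rfl fun m _ => by simp [ite_mul]

theorem inputDist_mem_stdSimplex [Fintype X] (P : CodeProcess K C Ω) (s : List Y) :
    P.inputDist s ∈ stdSimplex ℝ X := by
  refine ⟨fun x => Finset.sum_nonneg fun m _ => ?_, ?_⟩
  · split_ifs
    · exact (P.posterior_pos m s).le
    · rfl
  · simpa [sum_posterior] using P.sum_inputDist_mul s fun _ => 1

theorem outDist_inputDist [Fintype X] (P : CodeProcess K C Ω) (s : List Y) :
    K.outDist (P.inputDist s) = P.pNext s := by
  ext y
  rw [pNext_eq_sum, ← P.sum_inputDist_mul s fun x => K.W x y, DMC.outDist]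
  exact Finset.sum_congr rfl fun x _ => mul_comm _ _

theorem posterior_append (P : CodeProcess K C Ω) (m : M) (s : List Y) (y : Y) :
    P.posterior m (s ++ [y]) = P.posterior m s * (K.W (C.enc m s) y / P.pNext s y) := by
  have h1 := (P.pOut_pos s).ne'
  have h2 := (P.pOut_pos (s ++ [y])).ne'
  simp only [posterior, pNext, pJoint_append]
  field_simp

/-- The expected decrease of the conditional entropy in one step is the mutual information of
the channel for the current input distribution. -/
theorem drift_neg_condEntropy [Fintype X] (P : CodeProcess K C Ω) (s : List Y) :
    P.drift (fun s => -P.condEntropy s) s = K.mutualInfo (P.inputDist s) := by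
  have hI : K.mutualInfo (P.inputDist s) = ∑ m, ∑ y, P.posterior m s *
      (K.W (C.enc m s) y * Real.log (K.W (C.enc m s) y / P.pNext s y)) := by
    simp only [DMC.mutualInfo, outDist_inputDist]
    rw [← Finset.sum_congr rfl fun m _ => Finset.mul_sum _ _ _,
      ← P.sum_inputDist_mul s fun x => ∑ y, K.W x y * Real.log (K.W x y / P.pNext s y)]
    refine Finset.sum_congr rfl fun x _ => ?_
    rw [Finset.mul_sum]
    exact Finset.sum_congr rfl fun y _ => by ring
  have hstep : ∀ y, P.pNext s y * P.condEntropy (s ++ [y]) =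
      ∑ m, (K.W (C.enc m s) y * Real.negMulLog (P.posterior m s) - P.posterior m s *
        (K.W (C.enc m s) y * Real.log (K.W (C.enc m s) y / P.pNext s y))) := by
    intro y
    rw [condEntropy, Finset.mul_sum]
    refine Finset.sum_congr rfl fun m _ => ?_
    have hψ := (P.pNext_pos s y).ne'
    rw [posterior_append, Real.negMulLog, Real.log_mul (P.posterior_pos m s).ne'
      (div_pos (K.pos _ y) (P.pNext_pos s y)).ne', Real.negMulLog]
    field_simp
    ring
  have hH : ∑ y, P.pNext s y * P.condEntropy (s ++ [y]) =
      P.condEntropy s - K.mutualInfo (P.inputDist s) := by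
    simp only [hstep]
    rw [Finset.sum_comm, hI]
    simp only [Finset.sum_sub_distrib]
    simp only [← Finset.sum_mul, K.sum_one, one_mul]
    rfl
  have hD : P.drift (fun s => -P.condEntropy s) s =
      (∑ y, P.pNext s y) * P.condEntropy s - ∑ y, P.pNext s y * P.condEntropy (s ++ [y]) := by
    rw [drift, Finset.sum_mul, ← Finset.sum_sub_distrib]
    exact Finset.sum_congr rfl fun y _ => by ring
  rw [hD, hH, sum_pNext]
  ring

/-! ### The tilted output distribution -/

/-- The density of the tilted distribution with respect to the original one, as a function of the
message and of the outputs so far; it is `1` until the list is formed. -/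
noncomputable def tiltWeight [Nonempty Y] (P : CodeProcess K C Ω) (T : (ℕ → Y) → ℕ∞)
    (A : List Y → Set M) (m : M) (s : List Y) : ℝ :=
  open Classical in
  if T (padded s) ≤ s.length then
    (A (cutAt T s)).indicator (fun _ => (P.posteriorList A (cutAt T s))⁻¹) m
  else 1

/-- The probability, under the tilted distribution, that the outputs start with `s`. -/
noncomputable def tiltOut [Nonempty Y] (P : CodeProcess K C Ω) (T : (ℕ → Y) → ℕ∞)
    (A : List Y → Set M) (s : List Y) : ℝ :=
  ∑ m, P.pJoint m s * P.tiltWeight T A m s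

theorem exists_firstLetters_eq_of_ae (P : CodeProcess K C Ω) {p : Ω → Prop}
    (hp : ∀ᵐ ω ∂P.μ, p ω) (s : List Y) :
    ∃ ω, firstLetters (P.out ω) s.length = s ∧ p ω := by
  by_contra! h
  have h0 : P.μ {ω | firstLetters (P.out ω) s.length = s} = 0 :=
    measure_mono_null (fun ω hω => h ω hω) hp
  have := P.pOut_pos s
  simp [pOut, measureReal_def, h0] at this

theorem pJoint_eq_posterior_mul (P : CodeProcess K C Ω) (m : M) (s : List Y) :
    P.pJoint m s = P.posterior m s * P.pOut s :=
  (div_mul_cancel₀ _ (P.pOut_pos s).ne').symm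

section Tilt

variable [Nonempty Y] {P : CodeProcess K C Ω} {T : (ℕ → Y) → ℕ∞} {A : List Y → Set M}

/-- Since every string has positive probability, nontriviality holds at every string that
reaches `T`. -/
theorem IsNALD.posteriorList_pos (h : P.IsNALD T A) {s : List Y}
    (hs : T (padded s) ≤ s.length) : 0 < P.posteriorList A (cutAt T s) := by
  obtain ⟨ω, hω, hpos⟩ := P.exists_firstLetters_eq_of_ae h.nontrivial s
  have h1 : T (P.out ω) ≤ s.length :=
    (h.markov.le_iff (by rw [firstLetters_padded, hω])).1 hs
  rwa [← h.markov.cutAt_firstLetters h1, hω] at hpos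

theorem IsNALD.tiltWeight_nonneg (h : P.IsNALD T A) (m : M) (s : List Y) :
    0 ≤ P.tiltWeight T A m s := by
  unfold tiltWeight
  split_ifs with hs
  · exact Set.indicator_nonneg (fun _ _ => inv_nonneg.2 (h.posteriorList_pos hs).le) _
  · exact zero_le_one

theorem IsNALD.tiltOut_pos (h : P.IsNALD T A) (s : List Y) : 0 < P.tiltOut T A s := by
  obtain ⟨m, hm⟩ : ∃ m, 0 < P.tiltWeight T A m s := by
    unfold tiltWeight
    split_ifs with hs
    · have hpos := h.posteriorList_pos hs
      obtain ⟨m, hm⟩ : ∃ m, m ∈ A (cutAt T s) := by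
        by_contra! hne
        simp [posteriorList, hne] at hpos
      exact ⟨m, by simpa [hm] using hpos⟩
    · exact ⟨P.nonempty_mes.some, zero_lt_one⟩
  exact Finset.sum_pos' (fun m _ => mul_nonneg (P.pJoint_pos m s).le (h.tiltWeight_nonneg m s))
    ⟨m, Finset.mem_univ m, mul_pos (P.pJoint_pos m s) hm⟩

/-- At the time `T` the outputs have the same probability under both distributions. -/
theorem IsNALD.tiltOut_eq_pOut (h : P.IsNALD T A) {s : List Y}
    (hs : T (padded s) = s.length) : P.tiltOut T A s = P.pOut s := by
  have hpos := h.posteriorList_pos hs.le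
  have hcut : cutAt T s = s := by
    have := h.markov.cutAt_firstLetters hs.le
    rwa [upTo_of_eq hs, firstLetters_padded] at this
  rw [hcut] at hpos
  have hterm : ∀ m, P.pJoint m s * P.tiltWeight T A m s =
      P.pOut s * ((A s).indicator (fun m => P.posterior m s) m * (P.posteriorList A s)⁻¹) := by
    intro m
    rw [tiltWeight, if_pos hs.le, hcut, pJoint_eq_posterior_mul]
    by_cases hm : m ∈ A s
    · simp [hm]; ring
    · simp [hm]
  rw [tiltOut, Finset.sum_congr rfl fun m _ => hterm m, ← Finset.mul_sum, ← Finset.sum_mul]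
  change P.pOut s * (P.posteriorList A s * _) = _
  rw [mul_inv_cancel₀ hpos.ne', mul_one]

theorem tiltOut_of_not_le {s : List Y} (hs : ¬ T (padded s) ≤ s.length) :
    P.tiltOut T A s = P.pOut s := by
  simp [tiltOut, tiltWeight, hs, pOut_eq_sum]

/-- Under the tilted distribution the channel acts on the outputs as under the original one. -/
theorem IsNALD.tiltOut_append (h : P.IsNALD T A) (s : List Y) (y : Y) :
    P.tiltOut T A (s ++ [y]) =
      ∑ m, P.pJoint m s * P.tiltWeight T A m s * K.W (C.enc m s) y := by
  have hfl : firstLetters (padded (s ++ [y])) s.length = s := by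
    have h1 := take_firstLetters (padded (s ++ [y])) (m := s.length) (n := (s ++ [y]).length)
      (by simp)
    rw [firstLetters_padded] at h1
    simpa using h1.symm
  have hiff : T (padded (s ++ [y])) ≤ s.length ↔ T (padded s) ≤ s.length :=
    h.markov.le_iff (by rw [hfl, firstLetters_padded])
  by_cases hs : T (padded s) ≤ s.length
  · have hs' := hiff.2 hs
    have hs'' : T (padded (s ++ [y])) ≤ (s ++ [y]).length := hs'.trans (by simp)
    have hcut : cutAt T (s ++ [y]) = cutAt T s := by
      have h1 := h.markov.cutAt_firstLetters hs'
      have h2 := h.markov.cutAt_firstLetters hs''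
      rw [hfl] at h1
      rw [firstLetters_padded] at h2
      rw [h1, h2]
    refine Finset.sum_congr rfl fun m _ => ?_
    rw [tiltWeight, tiltWeight, if_pos hs, if_pos hs'', hcut, pJoint_append]
    ring
  · have hR : ∑ m, P.pJoint m s * P.tiltWeight T A m s * K.W (C.enc m s) y =
        P.pOut (s ++ [y]) := by
      simp [tiltWeight, hs, pOut_append]
    rw [hR]
    -- the density changes only if `T` is reached at the new letter, where it averages to one
    by_cases hs' : T (padded (s ++ [y])) ≤ (s ++ [y]).length
    · refine h.tiltOut_eq_pOut (le_antisymm hs' ?_)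
      rw [← hiff, not_le] at hs
      simpa using Order.add_one_le_of_lt hs
    · exact tiltOut_of_not_le hs'

/-- The log-likelihood ratio of the original to the tilted output distribution. -/
noncomputable def logRatio (P : CodeProcess K C Ω) (T : (ℕ → Y) → ℕ∞)
    (A : List Y → Set M) (s : List Y) : ℝ :=
  Real.log (P.pOut s / P.tiltOut T A s)

theorem IsNALD.logRatio_append_sub (h : P.IsNALD T A) (s : List Y) (y : Y) :
    P.logRatio T A (s ++ [y]) - P.logRatio T A s = Real.log (P.pNext s y /
      ∑ m, P.pJoint m s * P.tiltWeight T A m s / P.tiltOut T A s * K.W (C.enc m s) y) := by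
  have h1 := P.pOut_pos s
  have h2 := P.pOut_pos (s ++ [y])
  have h3 := h.tiltOut_pos s
  have h4 := h.tiltOut_pos (s ++ [y])
  have h5 : ∑ m, P.pJoint m s * P.tiltWeight T A m s / P.tiltOut T A s * K.W (C.enc m s) y =
      P.tiltOut T A (s ++ [y]) / P.tiltOut T A s := by
    rw [h.tiltOut_append, Finset.sum_div]
    exact Finset.sum_congr rfl fun m _ => by ring
  rw [h5, logRatio, logRatio, ← Real.log_div (by positivity) (by positivity), pNext]
  congr 1
  field_simp

theorem IsNALD.sum_tilted_posterior (h : P.IsNALD T A) (s : List Y) :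
    ∑ m, P.pJoint m s * P.tiltWeight T A m s / P.tiltOut T A s = 1 := by
  rw [← Finset.sum_div]
  exact div_self (h.tiltOut_pos s).ne'

theorem IsNALD.exists_abs_logRatio_sub_le [Fintype X] (h : P.IsNALD T A) :
    ∃ c, ∀ s y, |P.logRatio T A (s ++ [y]) - P.logRatio T A s| ≤ c := by
  obtain ⟨b, hb0, hb1, hb⟩ := K.exists_pos_le_W
  have hmix : ∀ (π : M → ℝ) (e : M → X) (y : Y), (∀ m, 0 ≤ π m) → ∑ m, π m = 1 →
      b ≤ ∑ m, π m * K.W (e m) y ∧ ∑ m, π m * K.W (e m) y ≤ 1 := by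
    intro π e y hπ hπ1
    constructor
    · calc b = ∑ m, π m * b := by rw [← Finset.sum_mul, hπ1, one_mul]
        _ ≤ _ := Finset.sum_le_sum fun m _ => mul_le_mul_of_nonneg_left (hb _ _) (hπ m)
    · calc ∑ m, π m * K.W (e m) y ≤ ∑ m, π m * 1 :=
          Finset.sum_le_sum fun m _ => mul_le_mul_of_nonneg_left (K.W_le_one _ _) (hπ m)
        _ = 1 := by simp [hπ1]
  refine ⟨-Real.log b, fun s y => ?_⟩
  obtain ⟨h1, h2⟩ := hmix (fun m => P.posterior m s) (fun m => C.enc m s) y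
    (fun m => (P.posterior_pos m s).le) (P.sum_posterior s)
  obtain ⟨h3, h4⟩ := hmix (fun m => P.pJoint m s * P.tiltWeight T A m s / P.tiltOut T A s)
    (fun m => C.enc m s) y (fun m => div_nonneg (mul_nonneg (P.pJoint_pos m s).le
      (h.tiltWeight_nonneg m s)) (h.tiltOut_pos s).le) (h.sum_tilted_posterior s)
  rw [← pNext_eq_sum] at h1 h2
  rw [h.logRatio_append_sub, Real.log_div (by linarith) (by linarith), abs_le]
  have l1 := Real.log_le_log hb0 h1
  have l2 := Real.log_nonpos (by linarith) h2
  have l3 := Real.log_le_log hb0 h3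
  have l4 := Real.log_nonpos (by linarith) h4
  constructor <;> linarith

theorem IsNALD.exists_drift_logRatio_le [Fintype X] (h : P.IsNALD T A) (s : List Y) :
    ∃ x, P.drift (P.logRatio T A) s ≤ K.klTo (P.pNext s) x := by
  simp only [drift, h.logRatio_append_sub]
  exact K.exists_sum_mul_log_le_klTo (P.pNext_pos s) (fun m => C.enc m s)
    (fun m => div_nonneg (mul_nonneg (P.pJoint_pos m s).le (h.tiltWeight_nonneg m s))
      (h.tiltOut_pos s).le) (h.sum_tilted_posterior s)

/-! ### Bound on the divergence -/

/-- Between two Markov times the log-likelihood ratio grows on average by at most the expected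
duration times the value of `J` at the entropy rate. -/
theorem IsNALD.integral_logRatio_sub_le [Fintype X] (h : P.IsNALD T A)
    (hfin : ∫⁻ ω, (C.time (P.out ω) : ENNReal) ∂P.μ < ⊤) {S S' : (ℕ → Y) → ℕ∞}
    (hS : IsMarkovTime S) (hS' : IsMarkovTime S')
    (hle : ∀ᵐ ω ∂P.μ, S (P.out ω) ≤ S' (P.out ω))
    (hle' : ∀ᵐ ω ∂P.μ, S' (P.out ω) ≤ C.time (P.out ω)) :
    ∫ ω, (P.logRatio T A (upTo S' (P.out ω)) - P.logRatio T A (upTo S (P.out ω))) ∂P.μ ≤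
      P.expDuration S S' * K.J (P.entropyRate S S') := by
  by_cases heq : ∀ᵐ ω ∂P.μ, S' (P.out ω) = S (P.out ω)
  · have h1 : P.expDuration S S' = 0 := by
      rw [expDuration, integral_eq_zero_of_ae]
      filter_upwards [heq] with ω hω
      simp [hω]
    rw [h1, zero_mul, integral_eq_zero_of_ae]
    filter_upwards [heq] with ω hω
    simp [upTo, hω]
  obtain ⟨c, hc⟩ := h.exists_abs_logRatio_sub_le
  have hent : ∀ (s : List Y) (y : Y),
      |(fun s => -P.condEntropy s) (s ++ [y]) - (fun s => -P.condEntropy s) s| ≤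
        Fintype.card M := fun s y => by
    have := P.abs_condEntropy_append_sub_le s y
    rwa [← abs_neg, neg_sub_neg, neg_sub]
  have := P.isFiniteMeasure_occupation hfin hS hS' hle'
  have hint : ∀ {g : List Y → ℝ} {c : ℝ}, (∀ s y, |g (s ++ [y]) - g s| ≤ c) →
      Integrable (P.drift g) (P.occupation S S') := fun hg => Integrable.of_bound
    (measurable_of_countable _).aestronglyMeasurable _
    (ae_of_all _ fun s => P.abs_drift_le hg s)
  have hJ := K.integral_le_mul_J (P.occupation S S') (hint hent) (hint hc)
    (ae_of_all _ fun s => by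
      obtain ⟨x, hx⟩ := h.exists_drift_logRatio_le s
      exact ⟨_, P.inputDist_mem_stdSimplex s, x, (P.drift_neg_condEntropy s).le,
        by rwa [outDist_inputDist]⟩)
  rw [P.real_occupation_univ hfin hS hS' hle hle',
    ← P.integral_sub_upTo hfin hS hS' hle hle' hc,
    ← P.integral_sub_upTo hfin hS hS' hle hle' hent] at hJ
  rw [entropyRate, if_neg heq]
  simpa only [neg_sub_neg] using hJ

end Tilt

end CodeProcess

/-! ### Data processing for a binary test -/

/-- The log-sum inequality on a set, for the density `r`. -/
theorem mul_log_div_le_setIntegral_neg_log {Ω : Type*} [MeasurableSpace Ω] {μ : Measure Ω}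
    [IsFiniteMeasure μ] {r : Ω → ℝ} (hr : ∀ ω, 0 < r ω) (hri : Integrable r μ)
    (hli : Integrable (fun ω => -Real.log (r ω)) μ) (G : Set Ω) :
    (μ.real G = 0 ∨ 0 < ∫ ω in G, r ω ∂μ) ∧
      μ.real G * Real.log (μ.real G / ∫ ω in G, r ω ∂μ) ≤ ∫ ω in G, -Real.log (r ω) ∂μ := by
  by_cases hG : μ G = 0
  · simp [measureReal_def, hG, Measure.restrict_eq_zero.2 hG]
  have hG' : 0 < μ.real G := by
    rw [measureReal_def]
    exact ENNReal.toReal_pos hG (measure_ne_top _ _)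
  have hb : 0 < ∫ ω in G, r ω ∂μ := by
    rw [integral_pos_iff_support_of_nonneg (fun ω => (hr ω).le) hri.restrict,
      Function.support_eq_univ fun ω => (hr ω).ne']
    simpa [pos_iff_ne_zero] using hG
  refine ⟨Or.inr hb, ?_⟩
  set κ := μ.real G / ∫ ω in G, r ω ∂μ with hκ
  have hκ0 : 0 < κ := div_pos hG' hb
  have h1 : ∫ ω in G, (Real.log κ + 1 - κ * r ω) ∂μ ≤ ∫ ω in G, -Real.log (r ω) ∂μ := by
    refine integral_mono ((integrable_const _).sub (hri.restrict.const_mul _)) hli.restrict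
      fun ω => ?_
    have := Real.log_le_sub_one_of_pos (mul_pos hκ0 (hr ω))
    rw [Real.log_mul hκ0.ne' (hr ω).ne'] at this
    change _ ≤ -Real.log (r ω)
    linarith
  rw [integral_sub (integrable_const _) (hri.restrict.const_mul _), integral_const_mul,
    integral_const] at h1
  have h2 : κ * ∫ ω in G, r ω ∂μ = μ.real G := div_mul_cancel₀ _ hb.ne'
  rw [h2, measureReal_restrict_apply_univ, smul_eq_mul] at h1
  linarith

/-- Data processing for the test `E`: the probability that the density `r` gives to an event of
probability `a` cannot be small unless the divergence is large. -/
theorem neg_binEntropy_sub_mul_log_le {Ω : Type*} [MeasurableSpace Ω] {μ : Measure Ω}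
    [IsProbabilityMeasure μ] {r : Ω → ℝ} (hr : ∀ ω, 0 < r ω) (hri : Integrable r μ)
    (hr1 : ∫ ω, r ω ∂μ = 1) (hli : Integrable (fun ω => -Real.log (r ω)) μ)
    {E : Set Ω} (hE : MeasurableSet E) :
    -Real.binEntropy (μ.real E) - μ.real E * Real.log (∫ ω in E, r ω ∂μ) ≤
      ∫ ω, -Real.log (r ω) ∂μ := by
  obtain ⟨h1, h2⟩ := mul_log_div_le_setIntegral_neg_log hr hri hli E
  obtain ⟨h3, h4⟩ := mul_log_div_le_setIntegral_neg_log hr hri hli Eᶜ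
  have h5 := integral_add_compl hE hli
  have h6 := integral_add_compl hE hri
  have h7 : 0 ≤ ∫ ω in E, r ω ∂μ := integral_nonneg fun ω => (hr ω).le
  rw [probReal_compl_eq_one_sub hE] at h3 h4
  set a := μ.real E
  set b := ∫ ω in E, r ω ∂μ
  set b' := ∫ ω in Eᶜ, r ω ∂μ
  have ha1 : a ≤ 1 := measureReal_le_one
  have h8 : a * Real.log (a / b) = a * Real.log a - a * Real.log b := by
    rcases h1 with h | h
    · simp [h]
    · by_cases ha : a = 0
      · simp [ha]
      · rw [Real.log_div ha h.ne']; ring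
  have h9 : (1 - a) * Real.log (1 - a) ≤ (1 - a) * Real.log ((1 - a) / b') := by
    rcases h3 with h | h
    · simp [h]
    · by_cases ha : 1 - a = 0
      · simp [ha]
      · rw [Real.log_div ha h.ne']
        have := Real.log_nonpos h.le (by linarith)
        exact mul_le_mul_of_nonneg_left (by linarith) (by linarith)
  rw [Real.binEntropy, Real.log_inv, Real.log_inv]
  linarith

namespace CodeProcess

variable {X Y M : Type*} [Fintype Y] [Fintype M] {K : DMC X Y} {C : VLCode X Y M}
  {Ω : Type*} [MeasurableSpace Ω]

/-! ### The tilted distribution at the decoding time -/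

theorem setOf_upTo_eq_ae (P : CodeProcess K C Ω) {T : (ℕ → Y) → ℕ∞}
    (hfin : ∀ᵐ ω ∂P.μ, T (P.out ω) < ⊤) {s : List Y} (hs : s ∈ stoppedStrings T) :
    ((fun ω => upTo T (P.out ω)) ⁻¹' {s} : Set Ω) =ᵐ[P.μ]
      {ω | firstLetters (P.out ω) s.length = s} := by
  rw [Filter.eventuallyEq_set]
  filter_upwards [hfin] with ω hω
  constructor
  · intro h
    have h' : upTo T (P.out ω) = s := h
    have hlen : s.length = (T (P.out ω)).toNat := by rw [← h', length_upTo]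
    change firstLetters _ _ = _
    rw [hlen]
    exact h'
  · intro h
    exact (upTo_of_eq (hs _ h)).trans h

theorem measure_upTo_eq_zero (P : CodeProcess K C Ω) {T : (ℕ → Y) → ℕ∞} (hT : IsMarkovTime T)
    (hfin : ∀ᵐ ω ∂P.μ, T (P.out ω) < ⊤) {s : List Y} (hs : s ∉ stoppedStrings T) :
    P.μ ((fun ω => upTo T (P.out ω)) ⁻¹' {s}) = 0 := by
  refine measure_mono_null (fun ω hω => ?_) hfin
  intro h
  have h' : upTo T (P.out ω) = s := hω
  exact hs (h' ▸ hT.upTo_mem_stoppedStrings h)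

theorem measure_mes_inter_upTo (P : CodeProcess K C Ω) {T : (ℕ → Y) → ℕ∞} (hT : IsMarkovTime T)
    (hfin : ∀ᵐ ω ∂P.μ, T (P.out ω) < ⊤) (m : M) (s : List Y) :
    P.μ ({ω | P.mes ω = m} ∩ (fun ω => upTo T (P.out ω)) ⁻¹' {s}) =
      ((P.posterior m s).toNNReal : ENNReal) * P.μ ((fun ω => upTo T (P.out ω)) ⁻¹' {s}) := by
  by_cases hs : s ∈ stoppedStrings T
  · have h := P.setOf_upTo_eq_ae hfin hs
    rw [measure_congr h, measure_congr ((Filter.EventuallyEq.refl _ _).inter h)]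
    have h1 : P.μ {ω | firstLetters (P.out ω) s.length = s} = ENNReal.ofReal (P.pOut s) := by
      simp [pOut]
    have h2 : P.μ ({ω | P.mes ω = m} ∩ {ω | firstLetters (P.out ω) s.length = s}) =
        ENNReal.ofReal (P.pJoint m s) := by
      simp [pJoint, Set.ofPred_and]
    rw [h1, h2, pJoint_eq_posterior_mul, ENNReal.ofReal_mul (P.posterior_pos m s).le]
    rfl
  · have h := P.measure_upTo_eq_zero hT hfin hs
    rw [h, mul_zero, measure_inter_null_of_null_right _ h]

/-- The message may be averaged out given the outputs up to a Markov time. -/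
theorem lintegral_mes_upTo (P : CodeProcess K C Ω) {T : (ℕ → Y) → ℕ∞} (hT : IsMarkovTime T)
    (hfin : ∀ᵐ ω ∂P.μ, T (P.out ω) < ⊤) (F : M → List Y → ENNReal) :
    ∫⁻ ω, F (P.mes ω) (upTo T (P.out ω)) ∂P.μ =
      ∫⁻ ω, ∑ m, ENNReal.ofReal (P.posterior m (upTo T (P.out ω))) *
        F m (upTo T (P.out ω)) ∂P.μ := by
  classical
  have hZ := P.measurable_upTo hT
  have hmeas : ∀ f : List Y → ENNReal, Measurable fun ω => f (upTo T (P.out ω)) :=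
    fun f => (measurable_of_countable f).comp hZ
  have hsplit : ∀ ω, F (P.mes ω) (upTo T (P.out ω)) = ∑ m,
      Set.indicator {ω | P.mes ω = m} (fun ω => F m (upTo T (P.out ω))) ω := fun ω => by
    simp [Set.indicator_apply]
  simp only [hsplit]
  rw [lintegral_finsetSum _ fun m _ => (hmeas (F m)).indicator (P.measurable_mes m),
    lintegral_finsetSum _ fun m _ => hmeas fun s => ENNReal.ofReal (P.posterior m s) * F m s]
  refine Finset.sum_congr rfl fun m _ => ?_
  rw [lintegral_indicator (P.measurable_mes m)]
  have h1 := map_restrict_eq_withDensity P.μ hZ _ _ (P.measure_mes_inter_upTo hT hfin m)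
  have h2 := congrArg (fun ν => ∫⁻ s, F m s ∂ν) h1
  rw [lintegral_map (measurable_of_countable _) hZ,
    lintegral_withDensity_eq_lintegral_mul _ (measurable_of_countable _)
      (measurable_of_countable _), lintegral_map (measurable_of_countable _) hZ] at h2
  exact h2

section Tilt

variable [Nonempty Y] {P : CodeProcess K C Ω} {T : (ℕ → Y) → ℕ∞} {A : List Y → Set M}

theorem tiltWeight_upTo (hT : IsMarkovTime T) {T' : (ℕ → Y) → ℕ∞} {y : ℕ → Y}
    (h : T y ≤ T' y) (h' : T' y < ⊤) (m : M) : P.tiltWeight T A m (upTo T' y) =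
      (A (upTo T y)).indicator (fun _ => (P.posteriorList A (upTo T y))⁻¹) m := by
  lift T' y to ℕ using h'.ne with n hn
  have hcut := hT.cutAt_firstLetters h
  rw [upTo_of_eq hn.symm, tiltWeight, hcut, if_pos]
  rw [length_firstLetters, ← hT.le_iff (y := y) (n := n) ?_]
  · exact h
  · simpa using (firstLetters_padded (firstLetters y n)).symm

theorem IsNALD.lintegral_tiltWeight (h : P.IsNALD T A) {T' : (ℕ → Y) → ℕ∞}
    (hT' : IsMarkovTime T') (hfin : ∀ᵐ ω ∂P.μ, T' (P.out ω) < ⊤) :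
    ∫⁻ ω, ENNReal.ofReal (P.tiltWeight T A (P.mes ω) (upTo T' (P.out ω))) ∂P.μ =
      ∫⁻ ω, ENNReal.ofReal
        (P.tiltOut T A (upTo T' (P.out ω)) / P.pOut (upTo T' (P.out ω))) ∂P.μ := by
  rw [P.lintegral_mes_upTo hT' hfin fun m s => ENNReal.ofReal (P.tiltWeight T A m s)]
  refine lintegral_congr fun ω => ?_
  simp only [← ENNReal.ofReal_mul (P.posterior_pos _ _).le]
  rw [← ENNReal.ofReal_sum_of_nonneg fun m _ =>
    mul_nonneg (P.posterior_pos _ _).le (h.tiltWeight_nonneg _ _), tiltOut, Finset.sum_div]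
  congr 1
  refine Finset.sum_congr rfl fun m _ => ?_
  rw [posterior]
  ring

theorem IsNALD.ae_tiltOut_upTo_eq (h : P.IsNALD T A) :
    ∀ᵐ ω ∂P.μ, P.tiltOut T A (upTo T (P.out ω)) = P.pOut (upTo T (P.out ω)) := by
  filter_upwards [h.finite] with ω hω
  refine h.tiltOut_eq_pOut (h.markov.upTo_mem_stoppedStrings hω _ (firstLetters_padded _))

/-- The tilted distribution has total mass one at the decoding time. -/
theorem IsNALD.lintegral_ratio (h : P.IsNALD T A) :
    ∫⁻ ω, ENNReal.ofReal
      (P.tiltOut T A (upTo C.time (P.out ω)) / P.pOut (upTo C.time (P.out ω))) ∂P.μ = 1 := by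
  rw [← h.lintegral_tiltWeight C.markov P.time_finite]
  -- the density does not change between `T` and the decoding time
  have h1 : ∫⁻ ω, ENNReal.ofReal (P.tiltWeight T A (P.mes ω) (upTo C.time (P.out ω))) ∂P.μ =
      ∫⁻ ω, ENNReal.ofReal (P.tiltWeight T A (P.mes ω) (upTo T (P.out ω))) ∂P.μ := by
    refine lintegral_congr_ae ?_
    filter_upwards [h.le_time, P.time_finite, h.finite] with ω hle hlt hlt'
    rw [tiltWeight_upTo h.markov hle hlt, tiltWeight_upTo h.markov le_rfl hlt']
  rw [h1, h.lintegral_tiltWeight h.markov h.finite]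
  have h2 : ∀ᵐ ω ∂P.μ, ENNReal.ofReal
      (P.tiltOut T A (upTo T (P.out ω)) / P.pOut (upTo T (P.out ω))) = 1 := by
    filter_upwards [h.ae_tiltOut_upTo_eq] with ω hω
    rw [hω, div_self (P.pOut_pos _).ne', ENNReal.ofReal_one]
  rw [lintegral_congr_ae h2]
  simp

theorem IsNALD.integrable_ratio (h : P.IsNALD T A) :
    Integrable (fun ω =>
      P.tiltOut T A (upTo C.time (P.out ω)) / P.pOut (upTo C.time (P.out ω))) P.μ := by
  refine ⟨((measurable_of_countable fun s => P.tiltOut T A s / P.pOut s).comp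
    (P.measurable_upTo C.markov)).aestronglyMeasurable, ?_⟩
  rw [hasFiniteIntegral_iff_ofReal
    (ae_of_all _ fun ω => (div_pos (h.tiltOut_pos _) (P.pOut_pos _)).le), h.lintegral_ratio]
  exact ENNReal.one_lt_top

theorem IsNALD.integral_ratio (h : P.IsNALD T A) :
    ∫ ω, P.tiltOut T A (upTo C.time (P.out ω)) / P.pOut (upTo C.time (P.out ω)) ∂P.μ = 1 := by
  rw [integral_eq_lintegral_of_nonneg_ae
    (ae_of_all _ fun ω => (div_pos (h.tiltOut_pos _) (P.pOut_pos _)).le)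
    h.integrable_ratio.aestronglyMeasurable, h.lintegral_ratio]
  rfl

theorem IsNALD.tiltedMass_eq (h : P.IsNALD T A) (m : M) {s : List Y}
    (hs : s ∈ stoppedStrings C.time) :
    P.tiltedMass T A m s = P.pJoint m s * P.tiltWeight T A m s := by
  have hle : T (padded s) ≤ s.length := by
    obtain ⟨ω, hω, hle⟩ := P.exists_firstLetters_eq_of_ae h.le_time s
    rw [hs _ hω] at hle
    exact (h.markov.le_iff (by rw [firstLetters_padded, hω])).1 hle
  have h1 := (h.posteriorList_pos hle).ne'
  have h2 := (P.pJoint_pos m (cutAt T s)).ne'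
  have h3 := (P.pOut_pos (cutAt T s)).ne'
  rw [tiltedMass, tiltWeight, if_pos hle]
  by_cases hm : m ∈ A (cutAt T s)
  · rw [Set.indicator_of_mem hm, Set.indicator_of_mem hm, posterior]
    field_simp
  · simp [hm]

/-- The tilted probability of an event that depends on the outputs only, as an integral with
respect to the original process. -/
theorem IsNALD.tiltedProb_eq (h : P.IsNALD T A) (E : Set (List Y)) :
    P.tiltedProb T A {p | p.2 ∈ E} =
      ∫ ω in {ω | upTo C.time (P.out ω) ∈ E},
        P.tiltOut T A (upTo C.time (P.out ω)) / P.pOut (upTo C.time (P.out ω)) ∂P.μ := by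
  classical
  have hZ := P.measurable_upTo C.markov
  set G : Set (List Y) := E ∩ stoppedStrings C.time with hG
  let r : List Y → ℝ := fun s => P.tiltOut T A s / P.pOut s
  have hri : Integrable r (P.μ.map fun ω => upTo C.time (P.out ω)) :=
    (integrable_map_measure (measurable_of_countable _).aestronglyMeasurable hZ.aemeasurable).2
      h.integrable_ratio
  have hri' : Integrable (E.indicator r) (P.μ.map fun ω => upTo C.time (P.out ω)) :=
    hri.indicator trivial
  have hpt : ∀ s, (P.μ.map fun ω => upTo C.time (P.out ω)).real {s} • E.indicator r s =
      G.indicator (P.tiltOut T A) s := by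
    intro s
    rw [measureReal_def, Measure.map_apply hZ (measurableSet_singleton s)]
    by_cases hs : s ∈ stoppedStrings C.time
    · rw [measure_congr (P.setOf_upTo_eq_ae P.time_finite hs)]
      change P.pOut s • _ = _
      by_cases hE : s ∈ E
      · rw [Set.indicator_of_mem hE, Set.indicator_of_mem (show s ∈ G from ⟨hE, hs⟩), smul_eq_mul]
        exact mul_div_cancel₀ _ (P.pOut_pos s).ne'
      · rw [Set.indicator_of_notMem hE,
          Set.indicator_of_notMem (show s ∉ G from fun h => hE h.1), smul_zero]
    · rw [P.measure_upTo_eq_zero C.markov P.time_finite hs,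
        Set.indicator_of_notMem (show s ∉ G from fun h => hs h.2)]
      simp
  have hR : ∫ ω in {ω | upTo C.time (P.out ω) ∈ E}, r (upTo C.time (P.out ω)) ∂P.μ =
      ∑' s, G.indicator (P.tiltOut T A) s := by
    have hEm : MeasurableSet {ω | upTo C.time (P.out ω) ∈ E} := hZ (t := E) trivial
    rw [← integral_indicator hEm]
    change ∫ ω, E.indicator r (upTo C.time (P.out ω)) ∂P.μ = _
    rw [← integral_map hZ.aemeasurable (f := E.indicator r)
      (measurable_of_countable _).aestronglyMeasurable, integral_countable hri']
    exact tsum_congr hpt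
  have hsum : Summable (G.indicator (P.tiltOut T A)) := by
    have h1 := (hasSum_integral_measure (μ := fun s =>
      ((P.μ.map fun ω => upTo C.time (P.out ω)) {s}) • Measure.dirac s) (f := E.indicator r)
      (by rwa [Measure.sum_smul_dirac])).summable
    refine h1.congr fun s => ?_
    rw [integral_smul_measure, integral_dirac, ← hpt]
    rfl
  change _ = ∫ ω in {ω | upTo C.time (P.out ω) ∈ E}, r (upTo C.time (P.out ω)) ∂P.μ
  rw [hR]
  let f : M × List Y → ℝ := fun p =>
    G.indicator (fun s => P.pJoint p.1 s * P.tiltWeight T A p.1 s) p.2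
  have hf0 : ∀ m s, 0 ≤ P.pJoint m s * P.tiltWeight T A m s := fun m s =>
    mul_nonneg (P.pJoint_pos m s).le (h.tiltWeight_nonneg m s)
  have hf : 0 ≤ f := fun p => Set.indicator_nonneg (fun s _ => hf0 _ _) _
  have hfm : ∀ m, Summable fun s => f (m, s) := fun m =>
    Summable.of_nonneg_of_le (fun s => hf (m, s)) (fun s => Set.indicator_le_indicator
      (Finset.single_le_sum (fun m _ => hf0 m s) (Finset.mem_univ m))) hsum
  have hfs : Summable f := (summable_prod_of_nonneg hf).2 ⟨hfm, (hasSum_fintype _).summable⟩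
  calc P.tiltedProb T A {p | p.2 ∈ E} = ∑' p, f p := by
        rw [tiltedProb, tsum_subtype
          {p : M × List Y | p ∈ {p : M × List Y | p.2 ∈ E} ∧ p.2 ∈ stoppedStrings C.time}
          fun p => P.tiltedMass T A p.1 p.2]
        refine tsum_congr fun p => ?_
        by_cases hp : p.2 ∈ G
        · refine (Set.indicator_of_mem (by exact hp) _).trans ?_
          exact (h.tiltedMass_eq _ hp.2).trans (Set.indicator_of_mem hp
            fun s => P.pJoint p.1 s * P.tiltWeight T A p.1 s).symm
        · refine (Set.indicator_of_notMem (fun h' => hp h') _).trans ?_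
          exact (Set.indicator_of_notMem hp _).symm
    _ = ∑ m, ∑' s, f (m, s) := by rw [hfs.tsum_prod, tsum_fintype]
    _ = ∑' s, ∑ m, f (m, s) := (Summable.tsum_finsetSum fun m _ => hfm m).symm
    _ = ∑' s, G.indicator (P.tiltOut T A) s := tsum_congr fun s => by
        by_cases hs : s ∈ G <;> simp [f, hs, tiltOut]

end Tilt

end CodeProcess

/-! ### The lower bound -/

namespace CodeProcess

variable {X Y M : Type*} [Fintype Y] [Fintype M] {K : DMC X Y} {C : VLCode X Y M}
  {Ω : Type*} [MeasurableSpace Ω] [Nonempty Y] {P : CodeProcess K C Ω}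
  {T : (ℕ → Y) → ℕ∞} {A : List Y → Set M}

/-- The decoded message lies outside the list unless the decoding is wrong or the list contains
the message. -/
theorem IsNALD.one_sub_le_real_est_notMem (h : P.IsNALD T A) :
    1 - P.errProb - P.probMesMem T A ≤ P.μ.real {ω | upTo C.time (P.out ω) ∈
      {s | C.dec s ∉ A (cutAt T s)}} := by
  set E := {ω | upTo C.time (P.out ω) ∈ {s | C.dec s ∉ A (cutAt T s)}}
  have h1 : P.μ.real Set.univ ≤
      P.μ.real (E ∪ ({ω | P.est ω ≠ P.mes ω} ∪ {ω | P.mes ω ∈ A (upTo T (P.out ω))})) := by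
    refine ENNReal.toReal_mono (measure_ne_top _ _) (measure_mono_ae ?_)
    filter_upwards [h.le_time, P.time_finite] with ω hle hlt _
    by_cases hE : ω ∈ E
    · exact Or.inl hE
    · refine Or.inr ?_
      have hE' : P.est ω ∈ A (upTo T (P.out ω)) := by
        rw [← h.markov.cutAt_upTo hle hlt]
        exact not_not.1 hE
      by_cases he : P.est ω = P.mes ω
      · exact Or.inr (by rwa [he] at hE')
      · exact Or.inl he
  have h2 := measureReal_union_le (μ := P.μ) E
    ({ω | P.est ω ≠ P.mes ω} ∪ {ω | P.mes ω ∈ A (upTo T (P.out ω))})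
  have h3 := measureReal_union_le (μ := P.μ) {ω | P.est ω ≠ P.mes ω}
    {ω | P.mes ω ∈ A (upTo T (P.out ω))}
  rw [probReal_univ] at h1
  simp only [errProb, probMesMem]
  linarith

/-- Lower bound for the tilted probability that the decoded message is not in the list, in terms
of a bound `d` for the divergence at the decoding time. -/
theorem IsNALD.exp_le_tiltedProb (h : P.IsNALD T A)
    (hhalf : P.probMesMem T A + P.errProb ≤ 1 / 2)
    (hint : Integrable (fun ω => P.logRatio T A (upTo C.time (P.out ω))) P.μ) {d : ℝ}
    (hd : ∫ ω, P.logRatio T A (upTo C.time (P.out ω)) ∂P.μ ≤ d) :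
    Real.exp ((-Real.binEntropy (P.errProb + P.probMesMem T A) - d) /
        (1 - P.errProb - P.probMesMem T A)) ≤
      P.tiltedProb T A {p | C.dec p.2 ∉ A (cutAt T p.2)} := by
  let r : Ω → ℝ := fun ω =>
    P.tiltOut T A (upTo C.time (P.out ω)) / P.pOut (upTo C.time (P.out ω))
  set E := {ω | upTo C.time (P.out ω) ∈ {s | C.dec s ∉ A (cutAt T s)}} with hE
  have hEm : MeasurableSet E := P.measurable_upTo C.markov
    (t := {s | C.dec s ∉ A (cutAt T s)}) trivial
  have hr : ∀ ω, 0 < r ω := fun ω => div_pos (h.tiltOut_pos _) (P.pOut_pos _)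
  have hlog : ∀ ω, -Real.log (r ω) = P.logRatio T A (upTo C.time (P.out ω)) := fun ω => by
    rw [logRatio, ← Real.log_inv, inv_div]
  have hli : Integrable (fun ω => -Real.log (r ω)) P.μ := by simpa only [hlog] using hint
  have hb : P.tiltedProb T A {p | C.dec p.2 ∉ A (cutAt T p.2)} = ∫ ω in E, r ω ∂P.μ :=
    h.tiltedProb_eq {s | C.dec s ∉ A (cutAt T s)}
  have ha := h.one_sub_le_real_est_notMem
  rw [← hE] at ha
  have hdp := neg_binEntropy_sub_mul_log_le hr h.integrable_ratio h.integral_ratio hli hEm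
  simp only [hlog] at hdp
  obtain ⟨hpos, -⟩ := mul_log_div_le_setIntegral_neg_log hr h.integrable_ratio hli E
  have hb1 : ∫ ω in E, r ω ∂P.μ ≤ 1 := by
    rw [← h.integral_ratio]
    exact setIntegral_le_integral h.integrable_ratio (ae_of_all _ fun ω => (hr ω).le)
  rw [hb]
  set b := ∫ ω in E, r ω ∂P.μ
  set a := P.μ.real E
  set p := 1 - P.errProb - P.probMesMem T A with hp
  have hp2 : 1 / 2 ≤ p := by linarith
  have ha1 : a ≤ 1 := measureReal_le_one
  have hb0 : 0 < b := hpos.resolve_left (by linarith)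
  have hent : Real.binEntropy a ≤ Real.binEntropy (P.errProb + P.probMesMem T A) := by
    rw [← Real.binEntropy_one_sub (P.errProb + P.probMesMem T A),
      show 1 - (P.errProb + P.probMesMem T A) = p by rw [hp]; ring]
    exact Real.binEntropy_strictAntiOn.antitoneOn ⟨by linarith, by linarith⟩
      ⟨by linarith, ha1⟩ ha
  rw [← Real.le_log_iff_exp_le hb0, div_le_iff₀ (by linarith)]
  -- `log b ≤ 0`, so `a` may be replaced by its lower bound `p`
  nlinarith [mul_nonneg (sub_nonneg.2 ha) (neg_nonneg.2 (Real.log_nonpos hb0.le hb1))]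

end CodeProcess

theorem lemma5 {X Y M : Type*} [Fintype X] [Fintype Y] [Nonempty Y] [Fintype M]
    {Ω : Type*} [MeasurableSpace Ω] (K : DMC X Y) (C : VLCode X Y M) (P : CodeProcess K C Ω)
    (hfin : ∫⁻ ω, (C.time (P.out ω) : ENNReal) ∂P.μ < ⊤)
    (k : ℕ) (T : ℕ → (ℕ → Y) → ℕ∞) (A : ℕ → List Y → Set M)
    (hT0 : T 0 = fun _ => 0) (hTlast : T (k + 1) = C.time)
    (hA : ∀ i ∈ Finset.Icc 1 k, P.IsNALD (T i) (A i))
    (hnest : ∀ᵐ ω ∂P.μ, ∀ j ∈ Finset.range (k + 1), T j (P.out ω) ≤ T (j + 1) (P.out ω)) :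
    ∀ i ∈ Finset.Icc 1 k, P.probMesMem (T i) (A i) + P.errProb ≤ 1 / 2 →
      Real.exp
          ((-Real.binEntropy (P.errProb + P.probMesMem (T i) (A i)) -
              ∑ j ∈ Finset.Icc (i + 1) (k + 1),
                P.expDuration (T (j - 1)) (T j) * K.J (P.entropyRate (T (j - 1)) (T j))) /
            (1 - P.errProb - P.probMesMem (T i) (A i))) ≤
        P.tiltedProb (T i) (A i) {p | C.dec p.2 ∉ A i (cutAt (T i) p.2)} := by
  intro i hi hhalf
  have h := hA i hi
  rw [Finset.mem_Icc] at hi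
  have hcases : ∀ j, 1 ≤ j → j ≤ k + 1 →
      IsMarkovTime (T j) ∧ ∀ᵐ ω ∂P.μ, T j (P.out ω) ≤ C.time (P.out ω) := by
    intro j hj1 hj
    rcases Nat.lt_or_ge k j with hkj | hkj
    · obtain rfl : j = k + 1 := by omega
      rw [hTlast]
      exact ⟨C.markov, ae_of_all _ fun ω => le_rfl⟩
    · have := hA j (Finset.mem_Icc.2 ⟨hj1, hkj⟩)
      exact ⟨this.markov, this.le_time⟩
  obtain ⟨c, hc⟩ := h.exists_abs_logRatio_sub_le
  let g : ℕ → Ω → ℝ := fun j ω => P.logRatio (T i) (A i) (upTo (T j) (P.out ω))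
  have hstep : ∀ j ∈ Finset.Ico i (k + 1), Integrable (fun ω => g (j + 1) ω - g j ω) P.μ ∧
      ∫ ω, (g (j + 1) ω - g j ω) ∂P.μ ≤
        P.expDuration (T j) (T (j + 1)) * K.J (P.entropyRate (T j) (T (j + 1))) := by
    intro j hj
    rw [Finset.mem_Ico] at hj
    obtain ⟨hm, -⟩ := hcases j (by omega) (by omega)
    obtain ⟨hm', hle'⟩ := hcases (j + 1) (by omega) (by omega)
    have hle : ∀ᵐ ω ∂P.μ, T j (P.out ω) ≤ T (j + 1) (P.out ω) :=
      hnest.mono fun ω hω => hω j (Finset.mem_range.2 hj.2)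
    exact ⟨P.integrable_sub_upTo hfin hm hm' hle hle' hc,
      h.integral_logRatio_sub_le hfin hm hm' hle hle'⟩
  -- the log-likelihood ratio vanishes at the time at which the list is formed
  have htel : (fun ω => P.logRatio (T i) (A i) (upTo C.time (P.out ω))) =ᵐ[P.μ]
      fun ω => ∑ j ∈ Finset.Ico i (k + 1), (g (j + 1) ω - g j ω) := by
    filter_upwards [h.ae_tiltOut_upTo_eq] with ω hω
    have h0 : g i ω = 0 := by
      simp only [g, CodeProcess.logRatio, hω, div_self (P.pOut_pos _).ne', Real.log_one]
    rw [Finset.sum_Ico_sub (fun j => g j ω) (by omega), h0, sub_zero]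
    simp only [g, hTlast]
  refine h.exp_le_tiltedProb hhalf
    ((integrable_congr htel).2 (integrable_finsetSum _ fun j hj => (hstep j hj).1)) ?_
  rw [integral_congr_ae htel, integral_finsetSum _ fun j hj => (hstep j hj).1]
  have hshift := Finset.sum_Ico_add' (fun j =>
    P.expDuration (T (j - 1)) (T j) * K.J (P.entropyRate (T (j - 1)) (T j))) i (k + 1) 1
  rw [show Finset.Icc (i + 1) (k + 1) = Finset.Ico (i + 1) (k + 1 + 1) by ext; simp,
    ← hshift]
  exact Finset.sum_le_sum fun j hj => (hstep j hj).2
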